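/- Let $0\le t<n$ be integers. **Model.** Processes are deterministic, asynchronous state machines with arbitrary local state sets, and every operation on a shared object is one atomic step. An execution is determined by the inputs of the $n$ processes and by an infinite schedule that names the process taking each step; a process that has decided only takes idle steps, and a process crashes if it is scheduled only finitely often. An execution is $t$-resilient if at most $t$ processes crash in it. * *Non-anonymous processes with atomic snapshot objects*: processes $P_0,\dots,P_{n-1}$, whose code may depend on their index, share an arbitrary family of $n$-ary atomic snapshot objects with arbitrary fixed initial contents; a step of $P_i$ either writes a value to the $i$-th component of one object (update) or reads all $n$ components of one object (scan). * *Anonymous processes with atomic weak set objects*: $n$ processes run one and the same code, started from an initial state that depends only on the input, and share finitely many atomic weak sets over an arbitrary value set, all initially empty; a step either adds a value to one weak set (add) or returns the set of all values added to one weak set so far (get). **Colorless tasks.** A colorless task is a triple $(\mathcal I,\mathcal O,\Delta)$ of abstract simplicial complexes $\mathcal I,\mathcal O$ and a map $\Delta$ that assigns to each simplex $s\in\mathcal I$ a subcomplex $\Delta(s)$ of $\mathcal O$, with $\Delta(s')\subseteq\Delta(s)$ whenever $s'\subseteq s$. A protocol for $n$ processes solves it $t$-resiliently if for every $s\in\mathcal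 I$, all inputs in $s$ (repetitions allowed) and every $t$-resilient execution with these inputs, every process that does not crash decides and the set of all decided values is a simplex of $\Delta(s)$. **Statement.** 1. (Anonymous BG simulation.) For every protocol $P$ of $n$ non-anonymous processes with atomic snapshot objects there is a protocol $Q$ for $n$ anonymous processes with atomic weak set objects such that for every $t$-resilient execution $\rho$ of $Q$ there is a $t$-resilient execution $\rho'$ of $P$ with the following properties: every input in $\rho'$ is the input of some process in $\rho$; every value decided in $\rho$ is decided by some process in $\rho'$; and if some process that does not crash in $\rho'$ decides in $\rho'$, then every process that does not crash in $\rho$ decides in $\rho$. 2. Consequently, every colorless task that is $t$-resilient solvable by $n$ non-anonymous processes with atomic snapshot objects is $t$-resilient solvable by $n$ anonymous processes with atomic weak set objects. -/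

import Mathlib

universe u

namespace Resilient

/-! ### Colorless tasks -/

/-- A colorless task: an input complex, an output complex and a carrier map between them.
Only the values of `carrier` on simplices of `input` matter. The vertices of a complex are the
points `v` with `{v}` a simplex. -/
structure ColorlessTask (A B : Type u) where
  input : PreAbstractSimplicialComplex A
  output : PreAbstractSimplicialComplex B
  carrier : Finset A → PreAbstractSimplicialComplex B
  carrier_le : ∀ s ∈ input, carrier s ≤ output
  carrier_mono : ∀ s ∈ input, ∀ s' ∈ input, s' ⊆ s → carrier s' ≤ carrier s

/-! ### Schedules and crash failures

An execution of `n` deterministic asynchronous processes is driven by a schedule that names, for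
every time instant, the process that performs the next atomic step. A process that has decided
performs only idle steps. A process crashes if it is scheduled only finitely often. -/

/-- The process `i` crashes in the schedule `σ`. -/
def Faulty {n : ℕ} (σ : ℕ → Fin n) (i : Fin n) : Prop :=
  {k : ℕ | σ k = i}.Finite

/-- At most `t` processes crash in the schedule `σ`. -/
def AtMostFaulty {n : ℕ} (t : ℕ) (σ : ℕ → Fin n) : Prop :=
  {i : Fin n | Faulty σ i}.ncard ≤ t

/-- The decisions `D` of the processes (`D i b`: process `i` decides `b`) in an execution with
schedule `σ` are correct for the input simplex `s` of the task `T`: every process that does not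
crash decides, and the decided values form a simplex of the image of `s`. -/
def ColorlessTask.Correct {A B : Type u} (T : ColorlessTask A B) {n : ℕ} (s : Finset A)
    (σ : ℕ → Fin n) (D : Fin n → B → Prop) : Prop :=
  (∀ i, ¬ Faulty σ i → ∃ b, D i b) ∧
    ∃ s' ∈ T.carrier s, (s' : Set B) = {b | ∃ i, D i b}

/-! ### Non-anonymous processes with atomic snapshot objects -/

/-- What a process of a snapshot protocol does next, depending on its local state: halt with a
decision, write a value to its own component of a snapshot object, or atomically read all `n`
components of a snapshot object. -/
inductive SnapshotAction (n : ℕ) (Obj Val State B : Type u) : Type u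
  | decide (b : B)
  | update (j : Obj) (w : Val) (next : State)
  | scan (j : Obj) (next : (Fin n → Val) → State)

/-- A protocol for `n` processes with names `i : Fin n` that communicate through a family of
`n`-ary atomic snapshot objects. The code depends on the name. -/
structure SnapshotProtocol (n : ℕ) (A B : Type u) where
  Obj : Type u
  Val : Type u
  State : Type u
  /-- initial contents of the snapshot objects -/
  mem₀ : Obj → Fin n → Val
  /-- initial local state for a given input -/
  start : Fin n → A → State
  code : Fin n → State → SnapshotAction n Obj Val State B

namespace SnapshotProtocol

variable {n : ℕ} {A B : Type u} (P : SnapshotProtocol n A B)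

/-- Global configurations. -/
structure Config where
  loc : Fin n → P.State
  mem : P.Obj → Fin n → P.Val

open scoped Classical in
/-- The atomic step of process `i`. -/
noncomputable def step (c : P.Config) (i : Fin n) : P.Config :=
  match P.code i (c.loc i) with
  | .decide _ => c
  | .update j w q =>
      ⟨Function.update c.loc i q, Function.update c.mem j (Function.update (c.mem j) i w)⟩
  | .scan j q => ⟨Function.update c.loc i (q (c.mem j)), c.mem⟩

/-- The configuration after `k` steps of the execution with inputs `x` and schedule `σ`. -/
noncomputable def run (x : Fin n → A) (σ : ℕ → Fin n) : ℕ → P.Config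
  | 0 => ⟨fun i => P.start i (x i), P.mem₀⟩
  | k + 1 => P.step (run x σ k) (σ k)

/-- Process `i` decides `b` in the execution with inputs `x` and schedule `σ`. -/
def Decides (x : Fin n → A) (σ : ℕ → Fin n) (i : Fin n) (b : B) : Prop :=
  ∃ k, P.code i ((P.run x σ k).loc i) = .decide b

/-- The protocol solves the task when at most `t` processes crash. -/
def Solves (t : ℕ) (T : ColorlessTask A B) : Prop :=
  ∀ s ∈ T.input, ∀ x : Fin n → A, (∀ i, x i ∈ s) →
    ∀ σ : ℕ → Fin n, AtMostFaulty t σ → T.Correct s σ (P.Decides x σ)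

end SnapshotProtocol

/-! ### Anonymous processes with atomic weak set objects -/

/-- What a process of a weak set protocol does next, depending on its local state: halt with a
decision, add a value to a weak set object, or get the set of all values added so far to a weak
set object. -/
inductive WeakSetAction (m : ℕ) (Val State B : Type u) : Type u
  | decide (b : B)
  | add (j : Fin m) (v : Val) (next : State)
  | get (j : Fin m) (next : Set Val → State)

/-- An anonymous protocol that uses finitely many atomic weak set objects: all processes run the
same code, and the initial state of a process depends on its input only. -/
structure WeakSetProtocol (A B : Type u) where
  numObj : ℕ
  Val : Type u
  State : Type u
  start : A → State
  code : State → WeakSetAction numObj Val State B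

namespace WeakSetProtocol

variable {A B : Type u} (Q : WeakSetProtocol A B)

/-- Global configurations of `n` processes. -/
structure Config (n : ℕ) where
  loc : Fin n → Q.State
  mem : Fin Q.numObj → Set Q.Val

/-- The atomic step of process `i`. -/
def step {n : ℕ} (c : Q.Config n) (i : Fin n) : Q.Config n :=
  match Q.code (c.loc i) with
  | .decide _ => c
  | .add j v q => ⟨Function.update c.loc i q, Function.update c.mem j (insert v (c.mem j))⟩
  | .get j q => ⟨Function.update c.loc i (q (c.mem j)), c.mem⟩

/-- The configuration after `k` steps of the execution with inputs `x` and schedule `σ`. All weak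
sets are initially empty. -/
def run {n : ℕ} (x : Fin n → A) (σ : ℕ → Fin n) : ℕ → Q.Config n
  | 0 => ⟨fun i => Q.start (x i), fun _ => ∅⟩
  | k + 1 => Q.step (run x σ k) (σ k)

/-- Process `i` decides `b` in the execution with inputs `x` and schedule `σ`. -/
def Decides {n : ℕ} (x : Fin n → A) (σ : ℕ → Fin n) (i : Fin n) (b : B) : Prop :=
  ∃ k, Q.code ((Q.run x σ k).loc i) = .decide b

/-- The protocol, run by `n` anonymous processes, solves the task when at most `t` of them
crash. -/
def Solves (n t : ℕ) (T : ColorlessTask A B) : Prop :=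
  ∀ s ∈ T.input, ∀ x : Fin n → A, (∀ i, x i ∈ s) →
    ∀ σ : ℕ → Fin n, AtMostFaulty t σ → T.Correct s σ (Q.Decides x σ)

/-- `n` anonymous processes running `Q`, at most `t` of which crash, simulate `n` non-anonymous
processes running `P`, at most `t` of which crash: to every execution of `Q` with at most `t`
crashes belongs an execution of `P` with at most `t` crashes, whose inputs are inputs of the
simulators, such that every value decided by a simulator is decided by a simulated process, and
if some simulated process that does not crash decides, then so does every simulator that does not
crash. -/
def Simulates {n : ℕ} (t : ℕ) (P : SnapshotProtocol n A B) : Prop :=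
  ∀ (x : Fin n → A) (σ : ℕ → Fin n), AtMostFaulty t σ →
    ∃ (x' : Fin n → A) (σ' : ℕ → Fin n), AtMostFaulty t σ' ∧
      Set.range x' ⊆ Set.range x ∧
      (∀ i b, Q.Decides x σ i b → ∃ j, P.Decides x' σ' j b) ∧
      ((∃ j, ¬ Faulty σ' j ∧ ∃ b, P.Decides x' σ' j b) →
        ∀ i, ¬ Faulty σ i → ∃ b, Q.Decides x σ i b)

end WeakSetProtocol

/-- The task is `t`-resilient solvable by `n` non-anonymous processes with atomic snapshot
objects. -/
def SolvableNonAnonymously {A B : Type u} (n t : ℕ) (T : ColorlessTask A B) : Prop :=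
  ∃ P : SnapshotProtocol n A B, P.Solves t T

/-- The task is `t`-resilient solvable by `n` anonymous processes with atomic weak set objects. -/
def SolvableAnonymously {A B : Type u} (n t : ℕ) (T : ColorlessTask A B) : Prop :=
  ∃ Q : WeakSetProtocol A B, Q.Solves n t T

end Resilient

/-! For each process `j` of `P` the simulators compute a common sequence of images (local state and
own components of the snapshot objects); agreement instance `(j, k)` fixes the `k`-th one. A
simulator that sees image `k` decided computes a candidate for image `k + 1` from the latest decided
images and proposes it. It halts as soon as a decided image carries a decision of `P`.

A round of an instance has two stages. In the first, a simulator announces its entry, leaves with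
success iff it then sees no successful departure, waits until every visible entry has a matching
departure, and proposes a canonical element of the set of winners. The second is an adopt-commit on
the proposals, which alone guarantees that at most one value is ever decided (`vote_locked`,
`dec_unique`).

The cost of anonymity is that simulators with equal messages cannot be told apart, so one may take
the departure of a twin for its own. This spoils the common set of winners only if the twins leave
with different outcomes (`Split`). Messages carry the record of all outcomes, so after a split the
two records differ forever; a pair of simulators splits at most once per instance and some round is
free of splits (`exists_not_split`). In that round all proposals coincide and nobody goes on to a
later one (`round_le_of_not_split`). Hence an instance that is reached but never decided is blocked
by a simulator that crashed between entry and departure (`blocked`). The turn is not passed on in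
between, so a crashed simulator blocks only one process of `P` (`ncard_blocked_le`).

The decided images form an execution of `P` (`exists_sparseRun`): an update takes effect when its
result is published, any other step when the winning candidate was computed. If some simulator
halts, this execution is cut off late enough and continued by round robin. Otherwise the processes
that crash in it are among the blocked ones, at most `t` in number. -/

namespace Resilient

/-! ### Anonymous agreement by rounds -/

/-- The record of the past attempts of a simulator: instance, round and outcome. -/
abbrev Hist (n : ℕ) : Type := List ((Fin n × ℕ) × ℕ × Bool)

/-- The values that simulators add to the weak set. The pair `e` names the agreement instance for
the `e.2`-th state of the simulated process `e.1`. -/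
inductive Msg (n : ℕ) (W : Type u) : Type u
  | enter (e : Fin n × ℕ) (r : ℕ) (h : Hist n) (w : W)
  | leave (e : Fin n × ℕ) (r : ℕ) (h : Hist n) (w : W) (b : Bool)
  | propose (e : Fin n × ℕ) (r : ℕ) (w : W)
  | vote (e : Fin n × ℕ) (r : ℕ) (b : Bool) (w : W)
  | dec (e : Fin n × ℕ) (w : W)

/-- The stages of a round of an agreement instance. -/
inductive Phase : Type
  | start
  | inside
  | waiting
  | proposed
  | voted

/-- The position of a simulator in the sequence of agreement instances of one simulated process. -/
structure Slot (W : Type u) : Type u where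
  idx : ℕ
  round : ℕ
  phase : Phase
  val : W

/-- The working state of a simulator. -/
structure Core (n : ℕ) (W : Type u) : Type u where
  turn : ℕ
  hist : Hist n
  slot : Fin n → Slot W

/-- What a simulator does next: get the weak set, add a value, or halt. -/
inductive Mode (n : ℕ) (W B : Type u) : Type u
  | ready
  | pend (m : Msg n W)
  | done (b : B)

/-- The local state of a simulator. -/
structure SimState (n : ℕ) (W B : Type u) : Type u where
  core : Core n W
  mode : Mode n W B

/-- The data that the agreement layer is run with: initial proposals, the proposal that follows a
decided value, and the output rule. -/
structure Spec (n : ℕ) (A B W : Type u) : Type u where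
  init : Fin n → A → W
  next : Fin n → W → Set (Msg n W) → W
  out : Set (Msg n W) → Option B

namespace Core

variable {n : ℕ} {W : Type u} [NeZero n]

/-- The simulated process whose turn it is. -/
def cur (c : Core n W) : Fin n := Fin.ofNat n c.turn

/-- The slot of the process whose turn it is. -/
def here (c : Core n W) : Slot W := c.slot c.cur

/-- The current agreement instance. -/
def inst (c : Core n W) : Fin n × ℕ := (c.cur, c.here.idx)

/-- Replace the turn and the current slot. -/
def put (c : Core n W) (k : ℕ) (s : Slot W) : Core n W :=
  ⟨k, c.hist, Function.update c.slot c.cur s⟩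

end Core

/-- Every simulator that entered the round has left it. -/
def Settled {n : ℕ} {W : Type u} (S : Set (Msg n W)) (e : Fin n × ℕ) (r : ℕ) : Prop :=
  ∀ h w, .enter e r h w ∈ S → ∃ b, .leave e r h w b ∈ S

/-- The values with which simulators left the round successfully. -/
def winners {n : ℕ} {W : Type u} (S : Set (Msg n W)) (e : Fin n × ℕ) (r : ℕ) : Set W :=
  {w | ∃ h, .leave e r h w true ∈ S}

open scoped Classical in
/-- A canonical element of a set, or a default value. -/
noncomputable def pick {W : Type u} (X : Set W) (d : W) : W :=
  if h : X.Nonempty then h.choose else d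

/-- A move of a simulator that has obtained the contents `S` of the weak set: the new working
state, and a value to be added. -/
inductive Move {n : ℕ} {A B W : Type u} [NeZero n] (I : Spec n A B W) (c : Core n W)
    (S : Set (Msg n W)) : Core n W → Option (Msg n W) → Prop
  -- This applies even when a decision is visible, since `advance` excludes the phase: only a crash
  -- or a halt keeps a simulator inside.
  | leave (b : Bool) (hp : c.here.phase = .inside)
      (hb : b = true ↔ ∀ h w, .leave c.inst c.here.round h w true ∉ S) :
      Move I c S
        ⟨c.turn + 1, c.hist ++ [(c.inst, c.here.round, b)],
          Function.update c.slot c.cur { c.here with phase := .waiting }⟩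
        (some (.leave c.inst c.here.round c.hist c.here.val b))
  | advance (w : W) (hp : c.here.phase ≠ .inside) (hw : .dec c.inst w ∈ S) :
      Move I c S (c.put (c.turn + 1) ⟨c.here.idx + 1, 0, .start, I.next c.cur w S⟩) none
  | enter (hp : c.here.phase = .start) (hu : ∀ w, .dec c.inst w ∉ S) :
      Move I c S (c.put c.turn { c.here with phase := .inside })
        (some (.enter c.inst c.here.round c.hist c.here.val))
  | wait (hp : c.here.phase = .waiting) (hu : ∀ w, .dec c.inst w ∉ S)
      (hs : ¬ Settled S c.inst c.here.round) :
      Move I c S (c.put (c.turn + 1) c.here) none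
  | propose (hp : c.here.phase = .waiting) (hu : ∀ w, .dec c.inst w ∉ S)
      (hs : Settled S c.inst c.here.round) :
      Move I c S
        (c.put (c.turn + 1)
          ⟨c.here.idx, c.here.round, .proposed,
            pick (winners S c.inst c.here.round) c.here.val⟩)
        (some (.propose c.inst c.here.round (pick (winners S c.inst c.here.round) c.here.val)))
  | vote (b : Bool) (hp : c.here.phase = .proposed) (hu : ∀ w, .dec c.inst w ∉ S)
      (hb : b = true ↔ ∀ u, .propose c.inst c.here.round u ∈ S → u = c.here.val) :
      Move I c S (c.put (c.turn + 1) { c.here with phase := .voted })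
        (some (.vote c.inst c.here.round b c.here.val))
  -- The slot is unchanged: the simulator moves on only by reading the decision, like all others.
  | commit (hp : c.here.phase = .voted) (hu : ∀ w, .dec c.inst w ∉ S)
      (hv : ∀ b u, .vote c.inst c.here.round b u ∈ S → b = true ∧ u = c.here.val) :
      Move I c S (c.put (c.turn + 1) c.here) (some (.dec c.inst c.here.val))
  | retry (u : W) (hp : c.here.phase = .voted) (hu : ∀ w, .dec c.inst w ∉ S)
      (hv : ¬ ∀ b u, .vote c.inst c.here.round b u ∈ S → b = true ∧ u = c.here.val)
      (ha : .vote c.inst c.here.round true u ∈ S ∨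
        (∀ u', .vote c.inst c.here.round true u' ∉ S) ∧ u = c.here.val) :
      Move I c S (c.put (c.turn + 1) ⟨c.here.idx, c.here.round + 1, .start, u⟩) none

/-! ### From the relation of moves to a deterministic protocol. -/

section

variable {n : ℕ} {A B W : Type u} [NeZero n]

/-- The values in `advance` and `retry` are not determined by the relation; `react` makes the
protocol deterministic by choosing a move. -/
theorem Move.total (I : Spec n A B W) (c : Core n W) (S : Set (Msg n W)) :
    ∃ q : Core n W × Option (Msg n W), Move I c S q.1 q.2 := by
  suffices h : ∃ c' o, Move I c S c' o by
    obtain ⟨c', o, h⟩ := h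
    exact ⟨(c', o), h⟩
  classical
  by_cases hin : c.here.phase = .inside
  · exact ⟨_, _, .leave (decide (∀ h w, Msg.leave c.inst c.here.round h w true ∉ S)) hin (by simp)⟩
  by_cases hd : ∃ w, Msg.dec c.inst w ∈ S
  · obtain ⟨w, hw⟩ := hd
    exact ⟨_, _, .advance w hin hw⟩
  push Not at hd
  match hp : c.here.phase with
  | .inside => exact absurd hp hin
  | .start => exact ⟨_, _, .enter hp hd⟩
  | .waiting =>
    by_cases hs : Settled S c.inst c.here.round
    · exact ⟨_, _, .propose hp hd hs⟩
    · exact ⟨_, _, .wait hp hd hs⟩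
  | .proposed =>
    exact ⟨_, _, .vote (decide (∀ u, Msg.propose c.inst c.here.round u ∈ S → u = c.here.val)) hp hd
      (by simp)⟩
  | .voted =>
    by_cases hv : ∀ b u, Msg.vote c.inst c.here.round b u ∈ S → b = true ∧ u = c.here.val
    · exact ⟨_, _, .commit hp hd hv⟩
    by_cases ha : ∃ u, Msg.vote c.inst c.here.round true u ∈ S
    · obtain ⟨u, hu⟩ := ha
      exact ⟨_, _, .retry u hp hd hv (.inl hu)⟩
    · push Not at ha
      exact ⟨_, _, .retry _ hp hd hv (.inr ⟨ha, rfl⟩)⟩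

/-- The reaction of a simulator to the contents of the weak set. -/
noncomputable def Spec.react (I : Spec n A B W) (c : Core n W) (S : Set (Msg n W)) :
    SimState n W B :=
  match I.out S with
  | some b => ⟨c, .done b⟩
  | none =>
    match (Move.total I c S).choose with
    | (c', none) => ⟨c', .ready⟩
    | (c', some m) => ⟨c', .pend m⟩

/-- The initial state of a simulator with input `a`. -/
def Spec.initState (I : Spec n A B W) (a : A) : SimState n W B :=
  ⟨⟨0, [], fun j => ⟨0, 0, .start, I.init j a⟩⟩, .ready⟩

/-- The anonymous protocol run by the simulators. -/
noncomputable def Spec.protocol (I : Spec n A B W) : WeakSetProtocol A B where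
  numObj := 1
  Val := Msg n W
  State := SimState n W B
  start := I.initState
  code s :=
    match s.mode with
    | .ready => .get 0 fun S => I.react s.core S
    | .pend m => .add 0 m ⟨s.core, .ready⟩
    | .done b => .decide b

/-- The atomic step of one simulator. -/
inductive Step (I : Spec n A B W) (S : Set (Msg n W)) (s : SimState n W B) :
    Set (Msg n W) → SimState n W B → Prop
  | halt (b : B) (hm : s.mode = .ready) (ho : I.out S = some b) : Step I S s S ⟨s.core, .done b⟩
  | quiet (c : Core n W) (hm : s.mode = .ready) (ho : I.out S = none)
      (h : Move I s.core S c none) : Step I S s S ⟨c, .ready⟩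
  | issue (c : Core n W) (m : Msg n W) (hm : s.mode = .ready) (ho : I.out S = none)
      (h : Move I s.core S c (some m)) : Step I S s S ⟨c, .pend m⟩
  | write (m : Msg n W) (hm : s.mode = .pend m) : Step I S s (insert m S) ⟨s.core, .ready⟩
  | idle (b : B) (hm : s.mode = .done b) : Step I S s S s

theorem Spec.step_react (I : Spec n A B W) (s : SimState n W B) (S : Set (Msg n W))
    (hm : s.mode = .ready) : Step I S s S (I.react s.core S) := by
  unfold Spec.react
  split
  · next b ho => exact .halt b hm ho
  · next ho =>
    have hq := (Move.total I s.core S).choose_spec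
    split
    · next c hc => rw [hc] at hq; exact .quiet c hm ho hq
    · next c m hc => rw [hc] at hq; exact .issue c m hm ho hq

/-- `M` and `st` are the contents of the weak set and the local states in an execution of the
agreement layer with inputs `x` and schedule `σ`. -/
structure Exec (I : Spec n A B W) (x : Fin n → A) (σ : ℕ → Fin n) (M : ℕ → Set (Msg n W))
    (st : ℕ → Fin n → SimState n W B) : Prop where
  mem_zero : M 0 = ∅
  st_zero : ∀ p, st 0 p = I.initState (x p)
  step : ∀ τ, Step I (M τ) (st τ (σ τ)) (M (τ + 1)) (st (τ + 1) (σ τ))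
  other : ∀ τ p, p ≠ σ τ → st (τ + 1) p = st τ p

/-- Together with `Spec.decides_iff` this replaces the concrete protocol by the relation `Exec`, on
which all later arguments rest. -/
theorem Spec.exec_protocol (I : Spec n A B W) (x : Fin n → A) (σ : ℕ → Fin n) :
    Exec I x σ (fun τ => (I.protocol.run x σ τ).mem (0 : Fin 1))
      (fun τ => (I.protocol.run x σ τ).loc) where
  mem_zero := rfl
  st_zero _ := rfl
  step τ := by
    change Step I ((I.protocol.run x σ τ).mem (0 : Fin 1)) _
      ((I.protocol.step (I.protocol.run x σ τ) (σ τ)).mem (0 : Fin 1))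
      ((I.protocol.step (I.protocol.run x σ τ) (σ τ)).loc (σ τ))
    generalize I.protocol.run x σ τ = g
    generalize σ τ = p
    obtain ⟨l, μ⟩ := g
    change Fin n → SimState n W B at l
    change Fin 1 → Set (Msg n W) at μ
    match hm : (l p).mode with
    | .ready =>
      have hc : I.protocol.code (l p) = .get (0 : Fin 1) fun S => I.react (l p).core S := by
        simp only [Spec.protocol, hm]
      have hs : I.protocol.step ⟨l, μ⟩ p
          = ⟨Function.update l p (I.react (l p).core (μ 0)), μ⟩ := by
        rw [WeakSetProtocol.step]
        simp only
        rw [hc]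
      rw [hs]
      change Step I (μ 0) (l p) (μ 0) (Function.update l p (I.react (l p).core (μ 0)) p)
      rw [Function.update_self]
      exact I.step_react (l p) (μ 0) hm
    | .pend m =>
      have hc : I.protocol.code (l p) = .add (0 : Fin 1) m ⟨(l p).core, .ready⟩ := by
        simp only [Spec.protocol, hm]
      have hs : I.protocol.step ⟨l, μ⟩ p
          = ⟨Function.update l p ⟨(l p).core, .ready⟩,
            Function.update μ (0 : Fin 1) (insert m (μ 0))⟩ := by
        rw [WeakSetProtocol.step]
        simp only
        rw [hc]
        rfl
      rw [hs]
      change Step I (μ 0) (l p) (Function.update μ (0 : Fin 1) (insert m (μ 0)) 0)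
        (Function.update l p ⟨(l p).core, .ready⟩ p)
      rw [Function.update_self, Function.update_self]
      exact .write m hm
    | .done b =>
      have hc : I.protocol.code (l p) = .decide b := by
        simp only [Spec.protocol, hm]
      have hs : I.protocol.step ⟨l, μ⟩ p = ⟨l, μ⟩ := by
        rw [WeakSetProtocol.step]
        simp only
        rw [hc]
      rw [hs]
      exact .idle b hm
  other τ p hp := by
    change (I.protocol.step (I.protocol.run x σ τ) (σ τ)).loc p = _
    unfold WeakSetProtocol.step
    split
    · rfl
    · exact Function.update_of_ne hp _ _
    · exact Function.update_of_ne hp _ _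

theorem Spec.decides_iff (I : Spec n A B W) (x : Fin n → A) (σ : ℕ → Fin n) (p : Fin n) (b : B) :
    I.protocol.Decides x σ p b ↔
      ∃ τ, ((I.protocol.run x σ τ).loc p : SimState n W B).mode = .done b := by
  refine exists_congr fun τ => ?_
  generalize (I.protocol.run x σ τ).loc p = s
  change SimState n W B at s
  match hm : s.mode with
  | .ready => simp [Spec.protocol, hm]
  | .pend m => simp [Spec.protocol, hm]
  | .done b => simp [Spec.protocol, hm]

end

/-! ### Safety of the agreement layer -/

/-- The value that a simulator is about to add. -/
def Mode.pending {n : ℕ} {W B : Type u} : Mode n W B → Set (Msg n W)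
  | .pend m => {m}
  | _ => ∅

/-- The values carried by a message about a round satisfy `G`. -/
def Msg.All {n : ℕ} {W : Type u} (G : Fin n × ℕ → ℕ → W → Prop) : Msg n W → Prop
  | .enter e r _ w => G e r w
  | .leave e r _ w _ => G e r w
  | .propose e r w => G e r w
  | .vote e r _ w => G e r w
  | .dec _ _ => True

/-- The positions recorded in a working state are backed by the contents of the weak set. -/
structure Core.Supported {n : ℕ} {W : Type u} [NeZero n] (c : Core n W) (S : Set (Msg n W)) :
    Prop where
  inside : ∀ j, (c.slot j).phase = .inside → c.cur = j ∧
    .enter (j, (c.slot j).idx) (c.slot j).round c.hist (c.slot j).val ∈ S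
  waiting : ∀ j, (c.slot j).phase = .waiting →
    ∃ h w b, .leave (j, (c.slot j).idx) (c.slot j).round h w b ∈ S
  proposed : ∀ j, (c.slot j).phase = .proposed →
    .propose (j, (c.slot j).idx) (c.slot j).round (c.slot j).val ∈ S
  voted : ∀ j, (c.slot j).phase = .voted →
    ∃ b, .vote (j, (c.slot j).idx) (c.slot j).round b (c.slot j).val ∈ S

theorem Msg.All.mono {n : ℕ} {W : Type u} {G G' : Fin n × ℕ → ℕ → W → Prop}
    (h : ∀ e r w, G e r w → G' e r w) {m : Msg n W} (hm : m.All G) : m.All G' := by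
  cases m <;> first | exact h _ _ _ hm | trivial

section

variable {n : ℕ} {A B W : Type u} [NeZero n]

theorem Core.Supported.mono {c : Core n W} {S S' : Set (Msg n W)} (h : c.Supported S)
    (hS : S ⊆ S') : c.Supported S' where
  inside j hj := ⟨(h.inside j hj).1, hS (h.inside j hj).2⟩
  waiting j hj := by
    obtain ⟨h', w, b, hm⟩ := h.waiting j hj
    exact ⟨h', w, b, hS hm⟩
  proposed j hj := hS (h.proposed j hj)
  voted j hj := by
    obtain ⟨b, hm⟩ := h.voted j hj
    exact ⟨b, hS hm⟩

/-- Support is kept when the current slot is replaced, provided the new slot is supported and no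
slot but the current one is entered. -/
theorem Core.Supported.replace {c : Core n W} {S S' : Set (Msg n W)} (h : c.Supported S)
    (hS : S ⊆ S') {k : ℕ} {l : Hist n} {s : Slot W}
    (hi : s.phase = .inside → k = c.turn ∧ .enter (c.cur, s.idx) s.round l s.val ∈ S')
    (hw : s.phase = .waiting → ∃ h w b, .leave (c.cur, s.idx) s.round h w b ∈ S')
    (hp : s.phase = .proposed → .propose (c.cur, s.idx) s.round s.val ∈ S')
    (hv : s.phase = .voted → ∃ b, .vote (c.cur, s.idx) s.round b s.val ∈ S') :
    Core.Supported ⟨k, l, Function.update c.slot c.cur s⟩ S' := by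
  have hne : ∀ j, j ≠ c.cur → (c.slot j).phase ≠ .inside := fun j hj hji =>
    hj (h.inside j hji).1.symm
  have h' := h.mono hS
  constructor <;> intro j <;> by_cases hj : j = c.cur
  · subst hj
    simp only [Function.update_self]
    intro hs
    obtain ⟨rfl, hm⟩ := hi hs
    exact ⟨rfl, hm⟩
  · simp only [Function.update_of_ne hj]
    exact fun hs => absurd hs (hne j hj)
  · subst hj
    simpa only [Function.update_self] using hw
  · simp only [Function.update_of_ne hj]
    exact h'.waiting j
  · subst hj
    simpa only [Function.update_self] using hp
  · simp only [Function.update_of_ne hj]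
    exact h'.proposed j
  · subst hj
    simpa only [Function.update_self] using hv
  · simp only [Function.update_of_ne hj]
    exact h'.voted j

theorem Move.supported {I : Spec n A B W} {c c' : Core n W} {S : Set (Msg n W)}
    {o : Option (Msg n W)} (hm : Move I c S c' o) (h : c.Supported S) :
    c'.Supported (S ∪ {m | o = some m}) := by
  have hS : S ⊆ S ∪ {m | o = some m} := Set.subset_union_left
  have keep := h.mono hS
  cases hm with
  | leave b hp hb =>
    refine h.replace hS ?_ (fun _ => ⟨c.hist, c.here.val, b, .inr rfl⟩) ?_ ?_ <;> simp
  | advance w hp hw =>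
    refine h.replace hS ?_ ?_ ?_ ?_ <;> simp
  | enter hp hu =>
    refine h.replace hS ?_ ?_ ?_ ?_ <;> simp [Core.inst]
  | wait hp hu hs =>
    refine h.replace hS ?_ (fun _ => keep.waiting _ hp) ?_ ?_ <;> simp [hp]
  | propose hp hu hs =>
    refine h.replace hS ?_ ?_ ?_ ?_ <;> simp [Core.inst]
  | vote b hp hu hb =>
    refine h.replace hS ?_ ?_ ?_ ?_ <;> simp [Core.inst]
  | commit hp hu hv =>
    refine h.replace hS ?_ ?_ ?_ (fun _ => keep.voted _ hp) <;> simp [hp]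
  | retry u hp hu hv ha =>
    refine h.replace hS ?_ ?_ ?_ ?_ <;> simp

namespace Exec

variable {I : Spec n A B W} {x : Fin n → A} {σ : ℕ → Fin n} {M : ℕ → Set (Msg n W)}
  {st : ℕ → Fin n → SimState n W B}

theorem mem_succ (E : Exec I x σ M st) (τ : ℕ) : M τ ⊆ M (τ + 1) := by
  have h := E.step τ
  generalize M (τ + 1) = S' at h ⊢
  generalize st (τ + 1) (σ τ) = s' at h
  cases h <;> simp

theorem mem_mono (E : Exec I x σ M st) : Monotone M :=
  monotone_nat_of_le_succ E.mem_succ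

/-- Induction over an execution for a property of single simulators. -/
theorem local_induction (E : Exec I x σ M st) {Φ : ℕ → Fin n → SimState n W B → Prop}
    (h0 : ∀ p, Φ 0 p (I.initState (x p))) (hmono : ∀ τ p s, Φ τ p s → Φ (τ + 1) p s)
    (hstep : ∀ τ s', s' = st (τ + 1) (σ τ) → Φ τ (σ τ) (st τ (σ τ)) →
      Step I (M τ) (st τ (σ τ)) (M (τ + 1)) s' → Φ (τ + 1) (σ τ) s') (τ : ℕ) (p : Fin n) : Φ τ p (st τ p) := by
  induction τ generalizing p with
  | zero => rw [E.st_zero]; exact h0 p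
  | succ τ ih =>
    by_cases hp : p = σ τ
    · subst hp
      exact hstep τ _ rfl (ih _) (E.step τ)
    · rw [E.other τ p hp]
      exact hmono τ p _ (ih p)

/-- The working state changes when a value is issued, one step before it is added; therefore the
pending value is counted as present. -/
theorem supported (E : Exec I x σ M st) (τ : ℕ) (p : Fin n) :
    (st τ p).core.Supported (M τ ∪ (st τ p).mode.pending) := by
  refine E.local_induction (Φ := fun τ _ s => s.core.Supported (M τ ∪ s.mode.pending))
    ?_ ?_ ?_ τ p
  · intro p
    constructor <;> simp [Spec.initState]
  · exact fun τ p s h => h.mono (Set.union_subset_union_left _ (E.mem_succ τ))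
  · intro τ s' _ h hs
    generalize M (τ + 1) = S' at hs ⊢
    cases hs with
    | halt b hm ho => simpa [hm, Mode.pending] using h
    | quiet c hm ho hv =>
      have := hv.supported (by simpa [hm, Mode.pending] using h)
      simpa [Mode.pending] using this
    | issue c m hm ho hv =>
      have := hv.supported (by simpa [hm, Mode.pending] using h)
      refine this.mono ?_
      rintro a (ha | ha)
      · exact .inl ha
      · exact .inr (Option.some.inj ha).symm
    | write m hm =>
      refine h.mono ?_
      rw [hm]
      simp [Mode.pending]
    | idle b hm => exact h

theorem supported_ready (E : Exec I x σ M st) {τ : ℕ} {p : Fin n} (h : (st τ p).mode = .ready) :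
    (st τ p).core.Supported (M τ) := by
  simpa [h, Mode.pending] using E.supported τ p

theorem pending_issued (E : Exec I x σ M st) {τ : ℕ} {p : Fin n} {m : Msg n W}
    (h : (st τ p).mode = .pend m) :
    ∃ τ' < τ, σ τ' = p ∧ (st τ' p).mode = .ready ∧
      (st (τ' + 1) p).core = (st τ p).core ∧
      Move I (st τ' p).core (M τ') (st τ p).core (some m) := by
  revert h
  refine E.local_induction (Φ := fun τ p s => s.mode = .pend m → ∃ τ' < τ, σ τ' = p ∧
    (st τ' p).mode = .ready ∧ (st (τ' + 1) p).core = s.core ∧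
    Move I (st τ' p).core (M τ') s.core (some m)) ?_ ?_ ?_ τ p
  · intro p h
    simp [Spec.initState] at h
  · intro τ p s h hs
    obtain ⟨τ', hτ, h⟩ := h hs
    exact ⟨τ', by omega, h⟩
  · intro τ s' hs' h hs
    generalize M (τ + 1) = S' at hs
    cases hs with
    | halt b hm ho => simp
    | quiet c hm ho hv => simp
    | issue c m' hm ho hv =>
      intro hs
      obtain rfl : m' = m := by simpa using hs
      exact ⟨τ, by omega, rfl, hm, by rw [← hs'], hv⟩
    | write m hm => simp
    | idle b hm => simp [hm]

/-- Traces a value back to the move that produced it, so that the preconditions of that move become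
facts about the contents of the weak set. -/
theorem issued (E : Exec I x σ M st) {τ : ℕ} {m : Msg n W} (h : m ∈ M τ) :
    ∃ τ' < τ, (st τ' (σ τ')).mode = .ready ∧
      ∃ c, c = (st (τ' + 1) (σ τ')).core ∧
        Move I (st τ' (σ τ')).core (M τ') c (some m) := by
  induction τ with
  | zero => simp [E.mem_zero] at h
  | succ τ ih =>
    by_cases hτ : m ∈ M τ
    · obtain ⟨τ', h1, h2⟩ := ih hτ
      exact ⟨τ', by omega, h2⟩
    · have hs := E.step τ
      generalize M (τ + 1) = S' at hs h
      generalize st (τ + 1) (σ τ) = s' at hs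
      cases hs with
      | write m' hm =>
        obtain rfl : m = m' := by simpa [hτ] using h
        obtain ⟨τ', h1, h2, h3, h4, h5⟩ := E.pending_issued hm
        refine ⟨τ', by omega, ?_, (st τ (σ τ)).core, ?_, ?_⟩ <;> rw [h2]
        exacts [h3, h4.symm, h5]
      | _ => exact absurd h hτ

theorem exists_first (E : Exec I x σ M st) {τ : ℕ} {m : Msg n W} (h : m ∈ M τ) :
    ∃ τ' < τ, m ∉ M τ' ∧ m ∈ M (τ' + 1) := by
  induction τ with
  | zero => simp [E.mem_zero] at h
  | succ τ ih =>
    by_cases hτ : m ∈ M τ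
    · obtain ⟨τ', h1, h2⟩ := ih hτ
      exact ⟨τ', by omega, h2⟩
    · exact ⟨τ, by omega, hτ, h⟩

/-- A property of the values in circulation that is inherited by new proposals holds for all of
them. -/
theorem propagate (E : Exec I x σ M st) {G : ℕ → Fin n × ℕ → ℕ → W → Prop}
    (hmono : ∀ τ e r w, G τ e r w → G (τ + 1) e r w)
    (h0 : ∀ j p, G 0 (j, 0) 0 (I.init j (x p)))
    (hadv : ∀ τ c w, c = (st τ (σ τ)).core → (st τ (σ τ)).mode = .ready →
      .dec c.inst w ∈ M τ → G (τ + 1) (c.cur, c.here.idx + 1) 0 (I.next c.cur w (M τ)))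
    (hretry : ∀ τ c u b, c = (st τ (σ τ)).core → (st τ (σ τ)).mode = .ready →
      .vote c.inst c.here.round b c.here.val ∈ M τ → G τ c.inst c.here.round c.here.val →
      (.vote c.inst c.here.round true u ∈ M τ ∧ G τ c.inst c.here.round u ∨
        (∀ u', .vote c.inst c.here.round true u' ∉ M τ) ∧ u = c.here.val) →
      G (τ + 1) c.inst (c.here.round + 1) u) (τ : ℕ) :
    (∀ m ∈ M τ, m.All (G τ)) ∧ ∀ p, (∀ j, G τ (j, ((st τ p).core.slot j).idx)
      ((st τ p).core.slot j).round ((st τ p).core.slot j).val) ∧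
      ∀ m ∈ (st τ p).mode.pending, m.All (G τ) := by
  induction τ with
  | zero => simp [E.mem_zero, E.st_zero, Spec.initState, Mode.pending, h0]
  | succ τ ih =>
    obtain ⟨ihM, ihp⟩ := ih
    have hM : ∀ m ∈ M (τ + 1), m.All (G (τ + 1)) := by
      intro m hm
      have hs := E.step τ
      generalize M (τ + 1) = S' at hs hm
      generalize st (τ + 1) (σ τ) = s' at hs
      cases hs with
      | write m' hm' =>
        rcases hm with rfl | hm
        · exact ((ihp (σ τ)).2 m (by simp [hm', Mode.pending])).mono (hmono τ)
        · exact (ihM m hm).mono (hmono τ)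
      | _ => exact (ihM m hm).mono (hmono τ)
    refine ⟨hM, fun p => ?_⟩
    by_cases hp : p = σ τ
    · subst hp
      obtain ⟨ihs, ihm⟩ := ihp (σ τ)
      have key : ∀ c o, (st τ (σ τ)).mode = .ready → Move I (st τ (σ τ)).core (M τ) c o →
          (∀ j, G (τ + 1) (j, (c.slot j).idx) (c.slot j).round (c.slot j).val) ∧
          ∀ m, o = some m → m.All (G (τ + 1)) := by
        intro c' o hr hm
        have hsup := E.supported_ready hr
        obtain ⟨c, hc⟩ : ∃ c, c = (st τ (σ τ)).core := ⟨_, rfl⟩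
        rw [← hc] at hm ihs hsup
        have hhere : G τ c.inst c.here.round c.here.val := ihs c.cur
        have hhere' := hmono _ _ _ _ hhere
        have upd : ∀ (s : Slot W) k l, G (τ + 1) (c.cur, s.idx) s.round s.val →
            ∀ j, G (τ + 1) (j, ((Core.mk k l (Function.update c.slot c.cur s)).slot j).idx)
              ((Core.mk k l (Function.update c.slot c.cur s)).slot j).round
              ((Core.mk k l (Function.update c.slot c.cur s)).slot j).val := by
          intro s k l hs j
          by_cases hj : j = c.cur
          · subst hj; simpa using hs
          · simpa [Function.update_of_ne hj] using hmono _ _ _ _ (ihs j)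
        cases hm with
        | leave b hp hb => exact ⟨upd _ _ _ hhere', by rintro m ⟨⟩; exact hhere'⟩
        | advance w hp hw => exact ⟨upd _ _ _ (hadv τ c w hc hr hw), by simp⟩
        | enter hp hu => exact ⟨upd _ _ _ hhere', by rintro m ⟨⟩; exact hhere'⟩
        | wait hp hu hs => exact ⟨upd _ _ _ hhere', by simp⟩
        | propose hp hu hs =>
          have hg : G (τ + 1) c.inst c.here.round
              (pick (winners (M τ) c.inst c.here.round) c.here.val) := by
            unfold pick
            split
            -- The picked value comes from the departure of a winner, hence already satisfies the
            -- property.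
            · next hne =>
              obtain ⟨h, hh⟩ := hne.choose_spec
              exact hmono _ _ _ _ (ihM _ hh)
            · exact hhere'
          exact ⟨upd _ _ _ hg, by rintro m ⟨⟩; exact hg⟩
        | vote b hp hu hb => exact ⟨upd _ _ _ hhere', by rintro m ⟨⟩; exact hhere'⟩
        | commit hp hu hv => exact ⟨upd _ _ _ hhere', by rintro m ⟨⟩; trivial⟩
        | retry u hp hu hv ha =>
          obtain ⟨b, hb⟩ := hsup.voted c.cur hp
          refine ⟨upd _ _ _ (hretry τ c u b hc hr hb hhere ?_), by simp⟩
          exact ha.imp (fun h => ⟨h, ihM _ h⟩) id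
      have hs := E.step τ
      generalize st (τ + 1) (σ τ) = s' at hs ⊢
      generalize M (τ + 1) = S' at hs
      cases hs with
      | halt b hm ho => exact ⟨fun j => hmono _ _ _ _ (ihs j), by simp [Mode.pending]⟩
      | quiet c hm ho hv => exact ⟨(key c none hm hv).1, by simp [Mode.pending]⟩
      | issue c m hm ho hv =>
        refine ⟨(key c _ hm hv).1, ?_⟩
        rintro m' rfl
        exact (key c _ hm hv).2 _ rfl
      | write m hm => exact ⟨fun j => hmono _ _ _ _ (ihs j), by simp [Mode.pending]⟩
      | idle b hm => exact ⟨fun j => hmono _ _ _ _ (ihs j), by simp [hm, Mode.pending]⟩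
    · rw [E.other τ p hp]
      exact ⟨fun j => hmono _ _ _ _ ((ihp p).1 j), fun m hm => ((ihp p).2 m hm).mono (hmono τ)⟩

/-! ### Adopt-commit and uniqueness of decisions. -/

theorem vote_propose (E : Exec I x σ M st) {τ : ℕ} {e : Fin n × ℕ} {r : ℕ} {b : Bool} {w : W}
    (h : .vote e r b w ∈ M τ) : ∃ τ' < τ, .propose e r w ∈ M τ' ∧
      (b = true ↔ ∀ u, .propose e r u ∈ M τ' → u = w) := by
  obtain ⟨τ', hτ, hr, c, -, hm⟩ := E.issued h
  cases hm with
  | vote b hp hu hb => exact ⟨τ', hτ, (E.supported_ready hr).proposed _ hp, hb⟩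

/-- Of two successful voters, the one that read later saw the proposal of the other. -/
theorem vote_true_unique (E : Exec I x σ M st) {τ τ' : ℕ} {e : Fin n × ℕ} {r : ℕ} {w w' : W}
    (h : .vote e r true w ∈ M τ) (h' : .vote e r true w' ∈ M τ') : w = w' := by
  obtain ⟨τ₁, -, h₁, hu₁⟩ := E.vote_propose h
  obtain ⟨τ₂, -, h₂, hu₂⟩ := E.vote_propose h'
  rcases le_total τ₁ τ₂ with hle | hle
  · exact hu₂.1 rfl _ (E.mem_mono hle h₁)
  · exact (hu₁.1 rfl _ (E.mem_mono hle h₂)).symm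

theorem dec_vote (E : Exec I x σ M st) {τ : ℕ} {e : Fin n × ℕ} {w : W} (h : .dec e w ∈ M τ) :
    ∃ r, ∃ τ' < τ, .vote e r true w ∈ M τ' ∧
      ∀ b u, .vote e r b u ∈ M τ' → b = true ∧ u = w := by
  obtain ⟨τ', hτ, hr, c, -, hm⟩ := E.issued h
  cases hm with
  | commit hp hu hv =>
    obtain ⟨b, hb⟩ := (E.supported_ready hr).voted _ hp
    have hb' : Msg.vote (st τ' (σ τ')).core.inst (st τ' (σ τ')).core.here.round b
        (st τ' (σ τ')).core.here.val ∈ M τ' := hb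
    obtain ⟨rfl, -⟩ := hv _ _ hb'
    exact ⟨_, τ', hτ, hb', hv⟩

/-- After a unanimous view of the votes of a round, all values in later rounds agree. -/
theorem vote_locked (E : Exec I x σ M st) {τ₀ : ℕ} {e : Fin n × ℕ} {r : ℕ} {w : W}
    (h : .vote e r true w ∈ M τ₀) (hv : ∀ b u, .vote e r b u ∈ M τ₀ → b = true ∧ u = w)
    {τ r' : ℕ} {b : Bool} {u : W} (hr : r < r') (hu : .vote e r' b u ∈ M τ) : u = w := by
  refine (E.propagate (G := fun _ e' r' u => e' = e → r < r' → u = w)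
    ?_ ?_ ?_ ?_ τ).1 _ hu rfl hr
  · exact fun _ _ _ _ h => h
  · exact fun _ _ _ hlt => absurd hlt (Nat.not_lt_zero _)
  · exact fun _ _ _ _ _ _ _ hlt => absurd hlt (Nat.not_lt_zero _)
  · intro τ c u b hc hm hown hG ha he hlt
    rcases Nat.lt_succ_iff_lt_or_eq.1 hlt with hlt | heq
    · rcases ha with ⟨-, ha⟩ | ⟨-, rfl⟩
      · exact ha he hlt
      · exact hG he hlt
    · rw [he, ← heq] at ha hown
      -- The simulator leaving round `r` either read after `τ₀`, and sees the given vote, or its own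
      -- vote belongs to the unanimous view.
      have hw : .vote e r true w ∈ M τ := by
        rcases le_total τ τ₀ with hle | hle
        · obtain ⟨rfl, rfl⟩ := hv _ _ (E.mem_mono hle hown)
          exact hown
        · exact E.mem_mono hle h
      rcases ha with ⟨ha, -⟩ | ⟨ha, -⟩
      · exact E.vote_true_unique ha hw
      · exact absurd hw (ha w)

/-- The commit in the earlier round locks the value of all votes in the later one. -/
theorem dec_unique (E : Exec I x σ M st) {τ τ' : ℕ} {e : Fin n × ℕ} {w w' : W}
    (h : .dec e w ∈ M τ) (h' : .dec e w' ∈ M τ') : w = w' := by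
  obtain ⟨r₁, τ₁, -, h₁, hv₁⟩ := E.dec_vote h
  obtain ⟨r₂, τ₂, -, h₂, hv₂⟩ := E.dec_vote h'
  rcases lt_trichotomy r₁ r₂ with hlt | rfl | hlt
  · exact (E.vote_locked h₁ hv₁ hlt h₂).symm
  · exact E.vote_true_unique h₁ h₂
  · exact E.vote_locked h₂ hv₂ hlt h₁

theorem dec_zero (E : Exec I x σ M st) {τ : ℕ} {j : Fin n} {w : W} (h : .dec (j, 0) w ∈ M τ) :
    ∃ p, w = I.init j (x p) := by
  obtain ⟨r, τ', -, hv, -⟩ := E.dec_vote h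
  refine (E.propagate (G := fun _ e _ u => e.2 = 0 → ∃ p, u = I.init e.1 (x p))
    ?_ ?_ ?_ ?_ τ').1 _ hv rfl
  · exact fun _ _ _ _ h => h
  · exact fun j p _ => ⟨p, rfl⟩
  · exact fun _ _ _ _ _ _ he => absurd he (Nat.succ_ne_zero _)
  · rintro τ c u b - - - hG (⟨-, ha⟩ | ⟨-, rfl⟩)
    · exact ha
    · exact hG

/-- The instant found here, a single `get` that shows image `k`, is where a simulated scan takes
effect. -/
theorem dec_succ_origin (E : Exec I x σ M st) {τ : ℕ} {j : Fin n} {k : ℕ} {w : W}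
    (h : .dec (j, k + 1) w ∈ M τ) : ∃ τ' < τ, (st τ' (σ τ')).mode = .ready ∧
      (st τ' (σ τ')).core.cur = j ∧ ∃ w₀, .dec (j, k) w₀ ∈ M τ' ∧ w = I.next j w₀ (M τ') := by
  obtain ⟨r, τ', hτ, hv, -⟩ := E.dec_vote h
  have := (E.propagate (G := fun τ e _ u => e = (j, k + 1) →
    ∃ τ' < τ, (st τ' (σ τ')).mode = .ready ∧
      (st τ' (σ τ')).core.cur = j ∧ ∃ w₀, .dec (j, k) w₀ ∈ M τ' ∧ u = I.next j w₀ (M τ'))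
    ?_ ?_ ?_ ?_ τ').1 _ hv rfl
  · obtain ⟨τ₁, h₁, h₂⟩ := this
    exact ⟨τ₁, h₁.trans hτ, h₂⟩
  · intro τ e r u hG he
    obtain ⟨τ₁, h₁, h₂⟩ := hG he
    exact ⟨τ₁, by omega, h₂⟩
  · intro j p he
    simp at he
  · intro τ c w hc hm hw he
    obtain ⟨hj, hk⟩ : c.cur = j ∧ c.here.idx = k := by simpa using he
    refine ⟨τ, by omega, hm, by rw [← hc, hj], w, ?_, by rw [hj]⟩
    rwa [Core.inst, hj, hk] at hw
  · rintro τ c u b - - - hG ha he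
    have : ∃ τ' < τ, (st τ' (σ τ')).mode = .ready ∧
      (st τ' (σ τ')).core.cur = j ∧ ∃ w₀, .dec (j, k) w₀ ∈ M τ' ∧ u = I.next j w₀ (M τ') := by
      rcases ha with ⟨-, ha⟩ | ⟨-, rfl⟩
      · exact ha he
      · exact hG he
    obtain ⟨τ₁, h₁, h₂⟩ := this
    exact ⟨τ₁, by omega, h₂⟩

end Exec

end

/-! ### Liveness of the agreement layer -/

/-- The mode of a simulator after a move. -/
def Mode.after {n : ℕ} {W B : Type u} : Option (Msg n W) → Mode n W B
  | none => .ready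
  | some m => .pend m

/-- The slot has got past the beginning of the round `r` of the instance with index `k`. -/
def Slot.Past {W : Type u} (k r : ℕ) (s : Slot W) : Prop :=
  k < s.idx ∨ s.idx = k ∧ (r < s.round ∨ s.round = r ∧ s.phase ≠ .start)

/-- The simulator has entered a round of the instance `e` and not yet left it. -/
def SimState.InZone {n : ℕ} {W B : Type u} [NeZero n] (s : SimState n W B) (e : Fin n × ℕ) :
    Prop :=
  (s.mode = .ready ∧ s.core.here.phase = .inside ∧ s.core.inst = e) ∨
    ∃ r h w b, s.mode = .pend (.leave e r h w b)

section

variable {n : ℕ} {A B W : Type u} [NeZero n]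

theorem SimState.InZone.unique {s : SimState n W B} {e e' : Fin n × ℕ} (h : s.InZone e)
    (h' : s.InZone e') : e = e' := by
  rcases h with ⟨hm, -, rfl⟩ | ⟨r, l, w, b, hm⟩ <;>
    rcases h' with ⟨hm', -, rfl⟩ | ⟨r', l', w', b', hm'⟩ <;> simp_all

namespace Move

variable {I : Spec n A B W} {c c' : Core n W} {S : Set (Msg n W)} {o : Option (Msg n W)}

theorem slot_of_ne (h : Move I c S c' o) {j : Fin n} (hj : j ≠ c.cur) :
    c'.slot j = c.slot j := by
  cases h <;> exact Function.update_of_ne hj _ _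

/-- Only `enter` keeps the turn, and the next move is then a departure; a simulator is thus inside
at most one instance. -/
theorem turn_eq (h : Move I c S c' o) :
    c'.turn = c.turn + 1 ∨ c'.turn = c.turn ∧ (c'.slot c.cur).phase = .inside := by
  cases h
  case enter => exact .inr ⟨rfl, by simp [Core.put]⟩
  all_goals exact .inl rfl

theorem turn_of_inside (h : Move I c S c' o) (hp : c.here.phase = .inside) :
    c'.turn = c.turn + 1 := by
  cases h
  case enter hp' _ => rw [hp] at hp'; cases hp'
  all_goals rfl

theorem hist_prefix (h : Move I c S c' o) : c.hist <+: c'.hist := by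
  cases h
  case leave => exact List.prefix_append _ _
  all_goals exact List.prefix_rfl

theorem idx_le (h : Move I c S c' o) : c.here.idx ≤ (c'.slot c.cur).idx := by
  cases h <;> simp [Core.put]

theorem advance_of_dec (h : Move I c S c' o) {w : W} (hw : .dec c.inst w ∈ S)
    (hp : c.here.phase ≠ .inside) : (c'.slot c.cur).idx = c.here.idx + 1 := by
  cases h
  case advance => simp [Core.put]
  case leave hp' _ => exact absurd hp' hp
  all_goals exact absurd hw (by simp_all)

theorem of_start (h : Move I c S c' o) (hu : ∀ w, .dec c.inst w ∉ S)
    (hp : c.here.phase = .start) : c'.slot c.cur = { c.here with phase := .inside } := by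
  cases h <;> simp_all [Core.put]

theorem of_inside (h : Move I c S c' o) (hp : c.here.phase = .inside) :
    c'.slot c.cur = { c.here with phase := .waiting } := by
  cases h <;> simp_all

theorem of_waiting (h : Move I c S c' o) (hu : ∀ w, .dec c.inst w ∉ S)
    (hp : c.here.phase = .waiting) :
    (c'.slot c.cur = c.here ∧ ¬ Settled S c.inst c.here.round) ∨
      ∃ w, c'.slot c.cur = ⟨c.here.idx, c.here.round, .proposed, w⟩ := by
  cases h <;> simp_all [Core.put]

theorem of_proposed (h : Move I c S c' o) (hu : ∀ w, .dec c.inst w ∉ S)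
    (hp : c.here.phase = .proposed) : c'.slot c.cur = { c.here with phase := .voted } := by
  cases h <;> simp_all [Core.put]

theorem of_voted (h : Move I c S c' o) (hu : ∀ w, .dec c.inst w ∉ S)
    (hp : c.here.phase = .voted) :
    o = some (.dec c.inst c.here.val) ∨
      ∃ w, c'.slot c.cur = ⟨c.here.idx, c.here.round + 1, .start, w⟩ := by
  cases h
  case commit => exact .inl rfl
  case retry u _ _ _ _ => exact .inr ⟨u, by simp [Core.put]⟩
  all_goals simp_all

theorem past (h : Move I c S c' o) {j : Fin n} {k r : ℕ} (hs : (c.slot j).Past k r) :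
    (c'.slot j).Past k r := by
  by_cases hj : j = c.cur
  · subst hj
    change c.here.Past k r at hs
    unfold Slot.Past at *
    cases h <;> simp_all [Core.put] <;> omega
  · rwa [h.slot_of_ne hj]

end Move

/-! ### Simulators that do not crash keep moving. -/

namespace Exec

variable {I : Spec n A B W} {x : Fin n → A} {σ : ℕ → Fin n} {M : ℕ → Set (Msg n W)}
  {st : ℕ → Fin n → SimState n W B}

theorem core_step (E : Exec I x σ M st) (τ : ℕ) (p : Fin n) :
    (st (τ + 1) p).core = (st τ p).core ∨ (σ τ = p ∧ (st τ p).mode = .ready ∧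
      ∃ o, Move I (st τ p).core (M τ) (st (τ + 1) p).core o) := by
  by_cases hp : p = σ τ
  · subst hp
    have hs := E.step τ
    generalize st (τ + 1) (σ τ) = s' at hs ⊢
    generalize M (τ + 1) = S' at hs
    cases hs with
    | quiet c hm ho h => exact .inr ⟨rfl, hm, none, h⟩
    | issue c m hm ho h => exact .inr ⟨rfl, hm, some m, h⟩
    | _ => exact .inl rfl
  · exact .inl (by rw [E.other τ p hp])

theorem core_induction (E : Exec I x σ M st) {p : Fin n} {Φ : Core n W → Prop} {τ₀ : ℕ}
    (h0 : Φ (st τ₀ p).core)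
    (hstep : ∀ τ ≥ τ₀, (st τ p).mode = .ready → ∀ c' o, Move I (st τ p).core (M τ) c' o →
      Φ (st τ p).core → Φ c') {τ : ℕ} (hτ : τ₀ ≤ τ) : Φ (st τ p).core := by
  induction τ, hτ using Nat.le_induction with
  | base => exact h0
  | succ τ hτ ih =>
    rcases E.core_step τ p with h | ⟨-, hm, o, h⟩
    · rwa [h]
    · exact hstep τ hτ hm _ o h ih

theorem st_eq_of_forall_ne (E : Exec I x σ M st) {p : Fin n} {τ τ' : ℕ} (hle : τ ≤ τ')
    (h : ∀ i, τ ≤ i → i < τ' → σ i ≠ p) : st τ' p = st τ p := by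
  induction τ', hle using Nat.le_induction with
  | base => rfl
  | succ τ' hle ih =>
    rw [E.other τ' p (h τ' hle (Nat.lt_succ_self _)).symm]
    exact ih fun i h1 h2 => h i h1 (by omega)

theorem next_step (E : Exec I x σ M st) {p : Fin n} (hp : ¬ Faulty σ p) (τ : ℕ) :
    ∃ τ' ≥ τ, σ τ' = p ∧ st τ' p = st τ p := by
  classical
  have hex : ∃ τ', τ ≤ τ' ∧ σ τ' = p := by
    obtain ⟨τ', h1, h2⟩ := Set.Infinite.exists_gt hp τ
    exact ⟨τ', h2.le, h1⟩
  obtain ⟨h1, h2⟩ := Nat.find_spec hex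
  refine ⟨Nat.find hex, h1, h2, E.st_eq_of_forall_ne h1 fun i hi hlt heq => ?_⟩
  exact Nat.find_min hex hlt ⟨hi, heq⟩

theorem step_pend (E : Exec I x σ M st) {τ : ℕ} {m : Msg n W}
    (h : (st τ (σ τ)).mode = .pend m) :
    M (τ + 1) = insert m (M τ) ∧ st (τ + 1) (σ τ) = ⟨(st τ (σ τ)).core, .ready⟩ := by
  have hs := E.step τ
  generalize st (τ + 1) (σ τ) = s' at hs ⊢
  generalize M (τ + 1) = S' at hs ⊢
  cases hs with
  | write m' hm =>
    obtain rfl : m' = m := by simpa [h] using hm.symm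
    exact ⟨rfl, rfl⟩
  | _ => simp_all

theorem step_ready (E : Exec I x σ M st) {τ : ℕ} (h : (st τ (σ τ)).mode = .ready) :
    M (τ + 1) = M τ ∧
      ((∃ b, I.out (M τ) = some b ∧ (st (τ + 1) (σ τ)).mode = .done b) ∨
        I.out (M τ) = none ∧
        ∃ o, Move I (st τ (σ τ)).core (M τ) (st (τ + 1) (σ τ)).core o ∧
          (st (τ + 1) (σ τ)).mode = .after o) := by
  have hs := E.step τ
  generalize st (τ + 1) (σ τ) = s' at hs ⊢
  generalize M (τ + 1) = S' at hs ⊢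
  cases hs with
  | halt b hm ho => exact ⟨rfl, .inl ⟨b, ho, rfl⟩⟩
  | quiet c hm ho hv => exact ⟨rfl, .inr ⟨ho, none, hv, rfl⟩⟩
  | issue c m hm ho hv => exact ⟨rfl, .inr ⟨ho, some m, hv, rfl⟩⟩
  | write m hm => simp [h] at hm
  | idle b hm => simp [h] at hm

theorem done_mono (E : Exec I x σ M st) {p : Fin n} {b : B} {τ τ' : ℕ} (hle : τ ≤ τ')
    (h : (st τ p).mode = .done b) : (st τ' p).mode = .done b := by
  induction τ', hle using Nat.le_induction with
  | base => exact h
  | succ τ' hle ih =>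
    by_cases hp : p = σ τ'
    · subst hp
      have hs := E.step τ'
      generalize st (τ' + 1) (σ τ') = s' at hs ⊢
      generalize M (τ' + 1) = S' at hs
      cases hs <;> simp_all
    · rw [E.other τ' p hp]
      exact ih

theorem done_out (E : Exec I x σ M st) {p : Fin n} {b : B} {τ : ℕ}
    (h : (st τ p).mode = .done b) : ∃ τ' < τ, I.out (M τ') = some b := by
  revert h
  refine E.local_induction
    (Φ := fun τ _ s => s.mode = .done b → ∃ τ' < τ, I.out (M τ') = some b) ?_ ?_ ?_ τ p
  · intro p h
    simp [Spec.initState] at h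
  · intro τ p s h hs
    obtain ⟨τ', h1, h2⟩ := h hs
    exact ⟨τ', by omega, h2⟩
  · intro τ s' _ h hs
    generalize M (τ + 1) = S' at hs
    cases hs with
    | halt b' hm ho =>
      intro hb
      obtain rfl : b' = b := by simpa using hb
      exact ⟨τ, by omega, ho⟩
    | quiet c hm ho hv => simp
    | issue c m' hm ho hv => simp
    | write m hm => simp
    | idle b hm =>
      intro hb
      obtain ⟨τ', h1, h2⟩ := h hb
      exact ⟨τ', by omega, h2⟩

/-- A simulator that keeps taking steps has completed its pending addition at some time. -/
theorem next_ready (E : Exec I x σ M st) {p : Fin n} (hp : ¬ Faulty σ p) (τ : ℕ) :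
    ∃ τ' ≥ τ, σ τ' = p ∧ (st τ' p).core = (st τ p).core ∧ (st τ p).mode.pending ⊆ M τ' ∧
      ((st τ' p).mode = .ready ∨ ∃ b, (st τ' p).mode = .done b) := by
  obtain ⟨τ₁, h₁, rfl, he⟩ := E.next_step hp τ
  match hm : (st τ (σ τ₁)).mode with
  | .ready => exact ⟨τ₁, h₁, rfl, by rw [he], by simp [Mode.pending], .inl (by rw [he, hm])⟩
  | .done b =>
    exact ⟨τ₁, h₁, rfl, by rw [he], by simp [Mode.pending], .inr ⟨b, by rw [he, hm]⟩⟩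
  | .pend m =>
    obtain ⟨hM, hs⟩ := E.step_pend (he ▸ hm)
    obtain ⟨τ₂, h₂, hσ, he₂⟩ := E.next_step hp (τ₁ + 1)
    refine ⟨τ₂, by omega, hσ, by rw [he₂, hs, he], ?_, .inl (by rw [he₂, hs])⟩
    have : m ∈ M (τ₁ + 1) := by rw [hM]; exact Set.mem_insert _ _
    simpa [Mode.pending] using E.mem_mono h₂ this

theorem halts_of_out (E : Exec I x σ M st) {p : Fin n} (hp : ¬ Faulty σ p) {τ₀ : ℕ}
    (ho : ∀ τ ≥ τ₀, I.out (M τ) ≠ none) : ∃ τ b, (st τ p).mode = .done b := by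
  obtain ⟨τ, hτ, rfl, -, -, hm | ⟨b, hb⟩⟩ := E.next_ready hp τ₀
  · rcases (E.step_ready hm).2 with ⟨b, -, hb⟩ | ⟨hn, -⟩
    · exact ⟨τ + 1, b, hb⟩
    · exact absurd hn (ho τ hτ)
  · exact ⟨τ, b, hb⟩

theorem next_move (E : Exec I x σ M st) {p : Fin n} (hp : ¬ Faulty σ p)
    (hh : ∀ τ p b, (st τ p).mode ≠ .done b) (τ : ℕ) :
    ∃ τ' ≥ τ, (st τ' p).core = (st τ p).core ∧ ∃ o,
      Move I (st τ' p).core (M τ') (st (τ' + 1) p).core o ∧ (st (τ' + 1) p).mode = .after o := by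
  obtain ⟨τ', hτ, rfl, hc, -, hm | ⟨b, hb⟩⟩ := E.next_ready hp τ
  · rcases (E.step_ready hm).2 with ⟨b, -, hb⟩ | ⟨-, o, hmv⟩
    · exact absurd hb (hh _ _ _)
    · exact ⟨τ', hτ, hc, o, hmv⟩
  · exact absurd hb (hh _ _ _)

/-- A simulator that keeps taking steps attends to every simulated process. -/
theorem visit (E : Exec I x σ M st) {p : Fin n} (hp : ¬ Faulty σ p)
    (hh : ∀ τ p b, (st τ p).mode ≠ .done b) (τ : ℕ) (j : Fin n) :
    ∃ τ' ≥ τ, (st τ' p).core.cur = j ∧ (st τ' p).core.here = (st τ p).core.slot j ∧ ∃ o,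
      Move I (st τ' p).core (M τ') (st (τ' + 1) p).core o ∧ (st (τ' + 1) p).mode = .after o := by
  have key : ∀ d τ, Fin.ofNat n ((st τ p).core.turn + d) = j → ∃ τ' ≥ τ,
      (st τ' p).core.cur = j ∧ (st τ' p).core.slot j = (st τ p).core.slot j ∧ ∃ o,
      Move I (st τ' p).core (M τ') (st (τ' + 1) p).core o ∧
        (st (τ' + 1) p).mode = .after o := by
    intro d
    induction d with
    | zero =>
      intro τ hj
      obtain ⟨τ', hτ, hc, o, hmv⟩ := E.next_move hp hh τ
      exact ⟨τ', hτ, by rw [hc]; exact hj, by rw [hc], o, hmv⟩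
    | succ d ih =>
      intro τ hj
      obtain ⟨τ₁, hτ₁, hc₁, o₁, hmv₁, hm₁⟩ := E.next_move hp hh τ
      by_cases hcur : j = (st τ₁ p).core.cur
      · exact ⟨τ₁, hτ₁, hcur.symm, by rw [hc₁], o₁, hmv₁, hm₁⟩
      have hs₁ := hmv₁.slot_of_ne hcur
      rcases hmv₁.turn_eq with ht | ⟨ht, hin⟩
      · obtain ⟨τ', hτ', h1, h2, h3⟩ := ih (τ₁ + 1) (by
          rw [ht, hc₁, Nat.add_right_comm]; exact hj)
        exact ⟨τ', by omega, h1, by rw [h2, hs₁, hc₁], h3⟩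
      -- After an entry, one further move, the departure, passes the turn on; neither move touches
      -- slot `j`.
      · obtain ⟨τ₂, hτ₂, hc₂, o₂, hmv₂, hm₂⟩ := E.next_move hp hh (τ₁ + 1)
        have hcur₂ : (st τ₂ p).core.cur = (st τ₁ p).core.cur := by
          rw [hc₂, Core.cur, ht, Core.cur]
        have hs₂ := hmv₂.slot_of_ne (hcur₂ ▸ hcur)
        have ht₂ := hmv₂.turn_of_inside (by rw [Core.here, hcur₂, hc₂]; exact hin)
        obtain ⟨τ', hτ', h1, h2, h3⟩ := ih (τ₂ + 1) (by
          rw [ht₂, hc₂, ht, hc₁, Nat.add_right_comm]; exact hj)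
        exact ⟨τ', by omega, h1, by rw [h2, hs₂, hc₂, hs₁, hc₁], h3⟩
  -- The distance is chosen so that the turn becomes `j + n * turn`, which is `j` modulo `n`.
  obtain ⟨τ', hτ, h1, h2, h3⟩ := key (j + n * (st τ p).core.turn - (st τ p).core.turn) τ (by
    have hle : (st τ p).core.turn ≤ n * (st τ p).core.turn :=
      Nat.le_mul_of_pos_left _ (NeZero.pos n)
    rw [show (st τ p).core.turn + (j + n * (st τ p).core.turn - (st τ p).core.turn)
      = j + n * (st τ p).core.turn by omega]
    ext
    simp [Nat.mod_eq_of_lt j.isLt])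
  exact ⟨τ', hτ, h1, by rw [Core.here, h1, h2], h3⟩

/-! #### Rounds without a split -/

theorem hist_prefix (E : Exec I x σ M st) (p : Fin n) {τ τ' : ℕ} (hle : τ ≤ τ') :
    (st τ p).core.hist <+: (st τ' p).core.hist :=
  E.core_induction (Φ := fun c => (st τ p).core.hist <+: c.hist) List.prefix_rfl
    (fun _ _ _ _ _ hm h => h.trans hm.hist_prefix) hle

theorem leave_hist (E : Exec I x σ M st) {τ : ℕ} {e : Fin n × ℕ} {r : ℕ} {h : Hist n} {w : W}
    {b : Bool} (hm : .leave e r h w b ∈ M τ) :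
    ∃ p τ', h ++ [(e, r, b)] <+: (st τ' p).core.hist := by
  obtain ⟨τ', -, -, c, hc, hmv⟩ := E.issued hm
  refine ⟨σ τ', τ' + 1, ?_⟩
  rw [← hc]
  cases hmv with
  | leave b hp hb => exact List.prefix_rfl

/-- Two simulators with the same record left the round in different ways. -/
def Split (M : ℕ → Set (Msg n W)) (e : Fin n × ℕ) (r : ℕ) : Prop :=
  ∃ h w, (∃ τ, .leave e r h w true ∈ M τ) ∧ ∃ τ, .leave e r h w false ∈ M τ

/-- If every round had a split, two rounds would be split by the same pair of simulators. The common
record before the second split would extend the two different records produced by the first. -/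
theorem exists_not_split (E : Exec I x σ M st) (e : Fin n × ℕ) : ∃ r, ¬ Split M e r := by
  by_contra! hall
  have h : ∀ r, ∃ (pq : Fin n × Fin n) (h : Hist n),
      (∃ τ, h ++ [(e, r, true)] <+: (st τ pq.1).core.hist) ∧
      ∃ τ, h ++ [(e, r, false)] <+: (st τ pq.2).core.hist := by
    intro r
    obtain ⟨h, w, ⟨τ, h₁⟩, τ', h₂⟩ := hall r
    obtain ⟨p, τ₁, hp⟩ := E.leave_hist h₁
    obtain ⟨q, τ₂, hq⟩ := E.leave_hist h₂
    exact ⟨(p, q), h, ⟨τ₁, hp⟩, τ₂, hq⟩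
  choose f h hp hq using h
  have cmp : ∀ (p : Fin n) (l l' : Hist n), (∃ τ, l <+: (st τ p).core.hist) →
      (∃ τ, l' <+: (st τ p).core.hist) → l.length ≤ l'.length → l <+: l' := by
    rintro p l l' ⟨τ, hl⟩ ⟨τ', hl'⟩ hle
    exact List.prefix_of_prefix_length_le (hl.trans (E.hist_prefix p (le_max_left τ τ')))
      (hl'.trans (E.hist_prefix p (le_max_right τ τ'))) hle
  have key : ∀ r r', f r = f r' → (h r).length ≤ (h r').length → r = r' := by
    intro r r' hf hle
    have h₁ := cmp (f r').1 _ _ (hf ▸ hp r) (hp r') (by simpa using hle)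
    have h₂ := cmp (f r').2 _ _ (hf ▸ hq r) (hq r') (by simpa using hle)
    -- Records of equal length end in the same entry, which names the round; otherwise `h r'`
    -- extends `h r` by both outcomes.
    rcases hle.eq_or_lt with heq | hlt
    · have := h₁.eq_of_length (by simpa using heq)
      have := List.append_inj_right' this rfl
      simpa using this
    · have h₁' : h r ++ [(e, r, true)] <+: h r' :=
        List.prefix_of_prefix_length_le h₁ (List.prefix_append _ _) (by simpa using hlt)
      have h₂' : h r ++ [(e, r, false)] <+: h r' :=
        List.prefix_of_prefix_length_le h₂ (List.prefix_append _ _) (by simpa using hlt)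
      have := (List.prefix_of_prefix_length_le h₁' h₂' (by simp)).eq_of_length (by simp)
      simp at this
  obtain ⟨r, r', hne, hf⟩ := Finite.exists_ne_map_eq_of_infinite f
  rcases le_total (h r).length (h r').length with hle | hle
  · exact hne (key r r' hf hle)
  · exact hne (key r' r hf.symm hle).symm

theorem leave_true (E : Exec I x σ M st) {τ : ℕ} {e : Fin n × ℕ} {r : ℕ} {h : Hist n} {w : W}
    (hm : .leave e r h w true ∈ M τ) :
    ∃ τ' < τ, .enter e r h w ∈ M τ' ∧ ∀ h' w', .leave e r h' w' true ∉ M τ' := by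
  obtain ⟨τ', hτ, hr, c, -, hmv⟩ := E.issued hm
  cases hmv with
  | leave b hp hb =>
    exact ⟨τ', hτ, ((E.supported_ready hr).inside _ hp).2, hb.1 rfl⟩

theorem leave_false (E : Exec I x σ M st) {τ : ℕ} {e : Fin n × ℕ} {r : ℕ} {h : Hist n} {w : W}
    (hm : .leave e r h w false ∈ M τ) : ∃ h' w', .leave e r h' w' true ∈ M τ := by
  obtain ⟨τ', hτ, hr, c, -, hmv⟩ := E.issued hm
  cases hmv with
  | leave b hp hb =>
    by_contra! hno
    exact Bool.false_ne_true (hb.2 fun h w hmem => hno h w (E.mem_mono hτ.le hmem))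

/-- A failed departure presupposes a successful one, so the default value of `pick` is never used.
-/
theorem propose_winners (E : Exec I x σ M st) {τ : ℕ} {e : Fin n × ℕ} {r : ℕ} {w : W}
    (hm : .propose e r w ∈ M τ) : ∃ τ', Settled (M τ') e r ∧ (winners (M τ') e r).Nonempty ∧
      ∃ d, w = pick (winners (M τ') e r) d := by
  obtain ⟨τ', hτ, hr, c, -, hmv⟩ := E.issued hm
  cases hmv with
  | propose hp hu hs =>
    refine ⟨τ', hs, ?_, _, rfl⟩
    obtain ⟨h, w, b, hl⟩ := (E.supported_ready hr).waiting _ hp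
    cases b with
    | true => exact ⟨w, h, hl⟩
    | false =>
      obtain ⟨h', w', hl'⟩ := E.leave_false hl
      exact ⟨w', h', hl'⟩

/-- A later winner saw no winner when it left, so it had entered before `τ`. A departure matching
its entry was then visible at `τ`; without a split that one is successful too. -/
theorem winners_eq (E : Exec I x σ M st) {e : Fin n × ℕ} {r : ℕ} (hns : ¬ Split M e r)
    {τ τ' : ℕ} (hle : τ ≤ τ') (hs : Settled (M τ) e r) (hne : (winners (M τ) e r).Nonempty) :
    winners (M τ) e r = winners (M τ') e r := by
  refine Set.Subset.antisymm (fun w ⟨h, hw⟩ => ⟨h, E.mem_mono hle hw⟩) ?_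
  rintro w ⟨h, hw⟩
  obtain ⟨τ₁, -, hen, hno⟩ := E.leave_true hw
  rcases le_total τ τ₁ with h₁ | h₁
  · obtain ⟨w', h', hw'⟩ := hne
    exact absurd (E.mem_mono h₁ hw') (hno h' w')
  · obtain ⟨b, hb⟩ := hs h w (E.mem_mono h₁ hen)
    cases b with
    | true => exact ⟨h, hb⟩
    | false => exact absurd ⟨h, w, ⟨τ', hw⟩, τ, hb⟩ hns

theorem pick_eq_of_nonempty {X : Set W} (h : X.Nonempty) (d d' : W) : pick X d = pick X d' := by
  simp [pick, h]

theorem propose_unique (E : Exec I x σ M st) {e : Fin n × ℕ} {r : ℕ} (hns : ¬ Split M e r)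
    {τ τ' : ℕ} {w w' : W} (h : .propose e r w ∈ M τ) (h' : .propose e r w' ∈ M τ') : w = w' := by
  obtain ⟨τ₁, hs₁, hne₁, d₁, rfl⟩ := E.propose_winners h
  obtain ⟨τ₂, hs₂, hne₂, d₂, rfl⟩ := E.propose_winners h'
  have heq : winners (M τ₁) e r = winners (M τ₂) e r := by
    rcases le_total τ₁ τ₂ with hle | hle
    · exact E.winners_eq hns hle hs₁ hne₁
    · exact (E.winners_eq hns hle hs₂ hne₂).symm
  rw [heq]
  exact pick_eq_of_nonempty hne₂ _ _

theorem vote_unanimous (E : Exec I x σ M st) {e : Fin n × ℕ} {r : ℕ} (hns : ¬ Split M e r)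
    {τ τ' : ℕ} {b b' : Bool} {w w' : W} (h : .vote e r b w ∈ M τ)
    (h' : .vote e r b' w' ∈ M τ') : b = true ∧ w = w' := by
  obtain ⟨τ₁, -, hp₁, hb₁⟩ := E.vote_propose h
  obtain ⟨τ₂, -, hp₂, hb₂⟩ := E.vote_propose h'
  exact ⟨hb₁.2 fun u hu => E.propose_unique hns hu hp₁, E.propose_unique hns hp₁ hp₂⟩

/-- Votes in an unsplit round are unanimous, so `retry` never applies there. -/
theorem round_le_of_not_split (E : Exec I x σ M st) {j : Fin n} {k r : ℕ}
    (hns : ¬ Split M (j, k) r) (τ : ℕ) (p : Fin n) :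
    ((st τ p).core.slot j).idx = k → ((st τ p).core.slot j).round ≤ r := by
  refine E.core_induction (p := p) (τ₀ := 0)
    (Φ := fun c => (c.slot j).idx = k → (c.slot j).round ≤ r) ?_ ?_ (Nat.zero_le τ)
  · simp [E.st_zero, Spec.initState]
  · intro τ _ hr c' o hmv ih
    have hsup := E.supported_ready hr
    generalize (st τ p).core = c at *
    by_cases hj : j = c.cur
    · subst hj
      change c.here.idx = k → c.here.round ≤ r at ih
      cases hmv with
      | advance => simp [Core.put]
      | retry u hp hu hv ha =>
        simp only [Core.put, Function.update_self]
        intro hk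
        refine Nat.succ_le_of_lt (lt_of_le_of_ne (ih hk) fun heq => hv fun b u hb => ?_)
        obtain ⟨b', hb'⟩ := hsup.voted _ hp
        change Msg.vote c.inst c.here.round b' c.here.val ∈ M τ at hb'
        have hi : c.inst = (c.cur, k) := by rw [Core.inst, hk]
        rw [hi, heq] at hb hb'
        exact E.vote_unanimous hns hb hb'
      | _ => simpa [Core.put] using ih
    · rwa [hmv.slot_of_ne hj]

/-! #### Progress -/

theorem idx_mono (E : Exec I x σ M st) (p j : Fin n) {τ τ' : ℕ} (hle : τ ≤ τ') :
    ((st τ p).core.slot j).idx ≤ ((st τ' p).core.slot j).idx := by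
  refine E.core_induction (Φ := fun c => ((st τ p).core.slot j).idx ≤ (c.slot j).idx) le_rfl
    (fun τ' _ _ c' o hmv h => ?_) hle
  by_cases hj : j = (st τ' p).core.cur
  · subst hj
    exact h.trans hmv.idx_le
  · rwa [hmv.slot_of_ne hj]

theorem idx_le_of_not_dec (E : Exec I x σ M st) {j : Fin n} {k : ℕ}
    (hu : ∀ τ w, .dec (j, k) w ∉ M τ) (τ : ℕ) (p : Fin n) :
    ((st τ p).core.slot j).idx ≤ k := by
  refine E.core_induction (p := p) (τ₀ := 0) (Φ := fun c => (c.slot j).idx ≤ k)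
    (by simp [E.st_zero, Spec.initState]) (fun τ _ _ c' o hmv h => ?_) (Nat.zero_le τ)
  generalize (st τ p).core = c at *
  by_cases hj : j = c.cur
  · subst hj
    change c.here.idx ≤ k at h
    cases hmv with
    | advance w hp hw =>
      simp only [Core.put, Function.update_self]
      refine Nat.succ_le_of_lt (lt_of_le_of_ne h fun heq => hu τ w ?_)
      rwa [Core.inst, heq] at hw
    | _ => simpa [Core.put] using h
  · rwa [hmv.slot_of_ne hj]

/-- Each visit after a decision is published moves the slot on; a slot found inside needs one more
visit, to leave first. -/
theorem exists_idx_eq (E : Exec I x σ M st) {p : Fin n} (hp : ¬ Faulty σ p)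
    (hh : ∀ τ p b, (st τ p).mode ≠ .done b) {j : Fin n} {k : ℕ}
    (hd : ∀ k' < k, ∃ τ w, .dec (j, k') w ∈ M τ) (hu : ∀ τ w, .dec (j, k) w ∉ M τ) :
    ∃ τ, ((st τ p).core.slot j).idx = k := by
  suffices h : ∀ i ≤ k, ∃ τ, i ≤ ((st τ p).core.slot j).idx by
    obtain ⟨τ, hτ⟩ := h k le_rfl
    exact ⟨τ, le_antisymm (E.idx_le_of_not_dec hu τ p) hτ⟩
  intro i
  induction i with
  | zero => exact fun _ => ⟨0, Nat.zero_le _⟩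
  | succ i ih =>
    intro hi
    obtain ⟨τ₁, hτ₁⟩ := ih (by omega)
    obtain ⟨τ₂, w, hw⟩ := hd i (by omega)
    have aux : ∀ τ ≥ max τ₁ τ₂, ((st τ p).core.slot j).phase ≠ .inside →
        ∃ τ, i + 1 ≤ ((st τ p).core.slot j).idx := by
      intro τ hτ hin
      have h₁ := E.idx_mono p j ((le_max_left τ₁ τ₂).trans hτ)
      obtain ⟨τ₃, hτ₃, hcur, hhere, o, hmv, -⟩ := E.visit hp hh τ j
      by_cases heq : ((st τ p).core.slot j).idx = i
      · refine ⟨τ₃ + 1, ?_⟩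
        have := hmv.advance_of_dec (w := w) (by
          rw [Core.inst, hcur, hhere, heq]
          exact E.mem_mono (((le_max_right τ₁ τ₂).trans hτ).trans hτ₃) hw) (by rwa [hhere])
        rw [hcur, hhere] at this
        omega
      · exact ⟨τ, by omega⟩
    by_cases hin : ((st (max τ₁ τ₂) p).core.slot j).phase = .inside
    · obtain ⟨τ₃, hτ₃, hcur, hhere, o, hmv, -⟩ := E.visit hp hh (max τ₁ τ₂) j
      have := hmv.of_inside (by rwa [hhere])
      refine aux (τ₃ + 1) (by omega) ?_
      rw [← hcur, this]
      simp
    · exact aux _ le_rfl hin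

/-- A simulator that entered a round and whose departure is never recorded has crashed inside. -/
theorem stuck_of_not_leave (E : Exec I x σ M st) (hh : ∀ τ p b, (st τ p).mode ≠ .done b)
    {τ : ℕ} {e : Fin n × ℕ} {r : ℕ} {h : Hist n} {w : W} (hen : .enter e r h w ∈ M τ)
    (hno : ∀ τ b, .leave e r h w b ∉ M τ) :
    ∃ p, Faulty σ p ∧ ∃ τ₀, ∀ τ ≥ τ₀, (st τ p).InZone e := by
  obtain ⟨τ₁, -, h₁, h₁'⟩ := E.exists_first hen
  obtain ⟨p, hp⟩ : ∃ p, p = σ τ₁ := ⟨_, rfl⟩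
  have hpend : (st τ₁ p).mode = .pend (.enter e r h w) := by
    rw [hp]
    have hs := E.step τ₁
    generalize M (τ₁ + 1) = S' at hs h₁'
    generalize st (τ₁ + 1) (σ τ₁) = s' at hs
    cases hs with
    | write m hm =>
      obtain rfl : Msg.enter e r h w = m := by simpa [h₁] using h₁'
      exact hm
    | _ => exact absurd h₁' h₁
  have hs₁ : st (τ₁ + 1) p = ⟨(st τ₁ p).core, .ready⟩ := by
    rw [hp]
    exact (E.step_pend (hp ▸ hpend)).2
  have hc : (st τ₁ p).core.here.phase = .inside ∧ (st τ₁ p).core.inst = e ∧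
      (st τ₁ p).core.here.round = r ∧ (st τ₁ p).core.hist = h ∧
      (st τ₁ p).core.here.val = w := by
    obtain ⟨τ', -, -, -, -, hmv⟩ := E.pending_issued hpend
    generalize (st τ₁ p).core = c at *
    cases hmv with
    | enter hp' hu => simp [Core.put, Core.here, Core.inst, Core.cur]
  -- The only move from inside issues the matching departure, which by assumption is never written.
  have hinv : ∀ τ ≥ τ₁ + 1, st τ p = ⟨(st τ₁ p).core, .ready⟩ ∨
      ∃ b, (st τ p).mode = .pend (.leave e r h w b) := by
    intro τ hτ
    induction τ, hτ using Nat.le_induction with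
    | base => exact .inl hs₁
    | succ τ hτ ih =>
      by_cases hpτ : p = σ τ
      · rcases ih with ih | ⟨b, hb⟩
        · right
          have hr : (st τ (σ τ)).mode = .ready := by rw [← hpτ, ih]
          rcases (E.step_ready hr).2 with ⟨b, -, hb⟩ | ⟨-, o, hmv, hm⟩
          · exact absurd hb (hh _ _ _)
          rw [← hpτ] at hmv hm
          rw [ih] at hmv
          simp only at hmv
          obtain ⟨hc1, rfl, rfl, rfl, rfl⟩ := hc
          rw [hm]
          generalize (st τ₁ p).core = c at *
          generalize (st (τ + 1) p).core = c' at hmv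
          cases hmv with
          | leave b _ _ => exact ⟨b, rfl⟩
          | _ => simp_all
        · refine absurd ?_ (hno (τ + 1) b)
          rw [(E.step_pend (hpτ ▸ hb)).1]
          exact Set.mem_insert _ _
      · rw [E.other τ p hpτ]
        exact ih
  have hfault : Faulty σ p := by
    by_contra hcor
    have hpd : ∀ τ b, (st τ p).mode ≠ .pend (.leave e r h w b) := by
      intro τ b hb
      obtain ⟨τ', -, -, -, hsub, -⟩ := E.next_ready hcor τ
      exact hno τ' b (hsub (by simp [hb, Mode.pending]))
    -- A correct simulator would write a pending departure, so it would stay ready with a frozen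
    -- working state; yet its next move increases the turn.
    have hst : ∀ τ ≥ τ₁ + 1, st τ p = ⟨(st τ₁ p).core, .ready⟩ := fun τ hτ =>
      (hinv τ hτ).resolve_right fun ⟨b, hb⟩ => hpd τ b hb
    obtain ⟨τ', hτ', -, o, hmv, -⟩ := E.next_move hcor hh (τ₁ + 1)
    have := hmv.turn_of_inside (by rw [hst τ' hτ']; exact hc.1)
    rw [hst τ' hτ', hst (τ' + 1) (by omega)] at this
    simp at this
  refine ⟨p, hfault, τ₁ + 1, fun τ hτ => ?_⟩
  rcases hinv τ hτ with hst | ⟨b, hb⟩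
  · exact .inl ⟨by rw [hst], by rw [hst]; exact hc.1, by rw [hst]; exact hc.2.1⟩
  · exact .inr ⟨r, h, w, b, hb⟩

/-- Each simulator gets past the beginning of a given round at most once. -/
theorem finite_enter (E : Exec I x σ M st) (e : Fin n × ℕ) (r : ℕ) :
    {q : Hist n × W | ∃ τ, .enter e r q.1 q.2 ∈ M τ}.Finite := by
  obtain ⟨j, k⟩ := e
  let F : Set ℕ := {τ | ¬ ((st τ (σ τ)).core.slot j).Past k r ∧
    ((st (τ + 1) (σ τ)).core.slot j).Past k r}
  have hF : F.Finite := by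
    have hpast : ∀ p τ τ', τ ≤ τ' → ((st τ p).core.slot j).Past k r →
        ((st τ' p).core.slot j).Past k r := fun p τ τ' hle h =>
      E.core_induction (Φ := fun c => (c.slot j).Past k r) h
        (fun _ _ _ _ _ hmv h => hmv.past h) hle
    refine Set.Finite.of_finite_image (f := σ) (Set.toFinite _) ?_
    intro τ hτ τ' hτ' heq
    rcases lt_trichotomy τ τ' with hlt | rfl | hlt
    · exact absurd (hpast _ _ _ hlt hτ.2) (heq ▸ hτ'.1)
    · rfl
    · exact absurd (hpast _ _ _ hlt hτ'.2) (heq ▸ hτ.1)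
  refine (hF.image fun τ => ((st τ (σ τ)).core.hist, (st τ (σ τ)).core.here.val)).subset ?_
  rintro ⟨h, w⟩ ⟨τ, hm⟩
  obtain ⟨τ', -, hr, c', hc', hmv⟩ := E.issued hm
  refine ⟨τ', ⟨?_, ?_⟩, ?_⟩
  · generalize (st τ' (σ τ')).core = c at *
    generalize hi : (j, k) = e at *
    cases hmv with
    | enter hp hu =>
      obtain ⟨rfl, rfl⟩ : j = c.cur ∧ k = c.here.idx := by simpa [Core.inst] using hi
      change ¬ c.here.Past _ _
      simp [Slot.Past, hp]
  · rw [← hc']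
    generalize (st τ' (σ τ')).core = c at *
    generalize hi : (j, k) = e at *
    cases hmv with
    | enter hp hu =>
      obtain ⟨rfl, rfl⟩ : j = c.cur ∧ k = c.here.idx := by simpa [Core.inst] using hi
      simp [Slot.Past, Core.put]
  · beta_reduce
    generalize (st τ' (σ τ')).core = c at *
    generalize (j, k) = e at *
    cases hmv with
    | enter hp hu => rfl

theorem eventually_settled (E : Exec I x σ M st) {e : Fin n × ℕ} {r : ℕ}
    (hl : ∀ τ h w, .enter e r h w ∈ M τ → ∃ τ' b, .leave e r h w b ∈ M τ') :
    ∃ τ₀, ∀ τ ≥ τ₀, Settled (M τ) e r := by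
  have := (Filter.eventually_all_finite (l := Filter.atTop) (E.finite_enter e r)
    (p := fun q τ => ∃ b, Msg.leave e r q.1 q.2 b ∈ M τ)).2 (by
      rintro ⟨h, w⟩ ⟨τ, hm⟩
      obtain ⟨τ', b, hb⟩ := hl τ h w hm
      exact Filter.eventually_atTop.2 ⟨τ', fun τ'' hle => ⟨b, E.mem_mono hle hb⟩⟩)
  obtain ⟨τ₀, h₀⟩ := Filter.eventually_atTop.1 this
  exact ⟨τ₀, fun τ hτ h w hm => h₀ τ hτ (h, w) ⟨τ, hm⟩⟩

/-- Every visit to the undecided instance advances the phase, except while waiting; as all entries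
are matched in the end, waiting ends too. -/
theorem round_unbounded (E : Exec I x σ M st) {p : Fin n} (hp : ¬ Faulty σ p)
    (hh : ∀ τ p b, (st τ p).mode ≠ .done b) {j : Fin n} {k : ℕ}
    (hu : ∀ τ w, .dec (j, k) w ∉ M τ)
    (hl : ∀ r τ h w, .enter (j, k) r h w ∈ M τ → ∃ τ' b, .leave (j, k) r h w b ∈ M τ')
    {τ : ℕ} (hk : ((st τ p).core.slot j).idx = k) (r : ℕ) :
    ∃ τ, ((st τ p).core.slot j).idx = k ∧ r ≤ ((st τ p).core.slot j).round := by
  have hvisit : ∀ τ, ((st τ p).core.slot j).idx = k → ∃ τ' ≥ τ, (st τ' p).core.cur = j ∧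
      (st τ' p).core.here = (st τ p).core.slot j ∧ (st τ' p).core.inst = (j, k) ∧
      (∀ w, .dec (st τ' p).core.inst w ∉ M τ') ∧ ∃ o,
      Move I (st τ' p).core (M τ') (st (τ' + 1) p).core o ∧
        (st (τ' + 1) p).mode = .after o := by
    intro τ hk
    obtain ⟨τ', hτ, hcur, hhere, hmv⟩ := E.visit hp hh τ j
    have hi : (st τ' p).core.inst = (j, k) := by rw [Core.inst, hcur, hhere, hk]
    exact ⟨τ', hτ, hcur, hhere, hi, fun w => hi ▸ hu τ' w, hmv⟩
  have voted : ∀ τ, ((st τ p).core.slot j).idx = k → ((st τ p).core.slot j).phase = .voted →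
      ∃ τ', ((st τ' p).core.slot j).idx = k ∧
        ((st τ p).core.slot j).round + 1 ≤ ((st τ' p).core.slot j).round := by
    intro τ hk hph
    obtain ⟨τ', hτ, hcur, hhere, hi, hun, o, hmv, hm⟩ := hvisit τ hk
    -- A commit is impossible: a correct simulator completes the addition, which would publish a
    -- decision.
    rcases hmv.of_voted hun (by rw [hhere, hph]) with rfl | ⟨w, hw⟩
    · obtain ⟨τ₁, -, -, -, hsub, -⟩ := E.next_ready hp (τ' + 1)
      refine absurd (hsub ?_) (hu τ₁ (st τ' p).core.here.val)
      rw [hm, hi]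
      rfl
    · rw [hcur, hhere] at hw
      exact ⟨τ' + 1, by rw [hw, hk], by rw [hw]⟩
  have proposed : ∀ τ, ((st τ p).core.slot j).idx = k →
      ((st τ p).core.slot j).phase = .proposed →
      ∃ τ', ((st τ' p).core.slot j).idx = k ∧
        ((st τ p).core.slot j).round + 1 ≤ ((st τ' p).core.slot j).round := by
    intro τ hk hph
    obtain ⟨τ', hτ, hcur, hhere, hi, hun, o, hmv, hm⟩ := hvisit τ hk
    have hw := hmv.of_proposed hun (by rw [hhere, hph])
    rw [hcur, hhere] at hw
    have := voted (τ' + 1) (by rw [hw, hk]) (by rw [hw])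
    rwa [hw] at this
  have waiting : ∀ τ, ((st τ p).core.slot j).idx = k →
      ((st τ p).core.slot j).phase = .waiting →
      ∃ τ', ((st τ' p).core.slot j).idx = k ∧
        ((st τ p).core.slot j).round + 1 ≤ ((st τ' p).core.slot j).round := by
    intro τ hk hph
    suffices h : ∃ τ' w, (st τ' p).core.slot j
        = ⟨k, ((st τ p).core.slot j).round, .proposed, w⟩ by
      obtain ⟨τ', w, hw⟩ := h
      have := proposed τ' (by rw [hw]) (by rw [hw])
      rwa [hw] at this
    by_contra! hnot
    obtain ⟨s, hs⟩ : ∃ s, s = (st τ p).core.slot j := ⟨_, rfl⟩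
    rw [← hs] at hk hph hnot
    obtain ⟨τ₀, h₀⟩ := E.eventually_settled (hl s.round)
    -- A slot that never proposes stays unchanged, so it is visited again after the round has
    -- settled.
    have hstay : ∀ τ' ≥ τ, (st τ' p).core.slot j = s := by
      intro τ' hτ'
      induction τ', hτ' using Nat.le_induction with
      | base => exact hs.symm
      | succ τ' hτ' ih =>
        rcases E.core_step τ' p with hc | ⟨-, -, o, hmv⟩
        · rw [hc, ih]
        · by_cases hcur : j = (st τ' p).core.cur
          · have hhere : (st τ' p).core.here = s := by rw [Core.here, ← hcur, ih]
            have hi : (st τ' p).core.inst = (j, k) := by rw [Core.inst, ← hcur, hhere, hk]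
            rcases hmv.of_waiting (fun w => hi ▸ hu τ' w) (by rw [hhere, hph]) with
              ⟨h, -⟩ | ⟨w, hw⟩
            · rw [hcur, h, hhere]
            · rw [← hcur, hhere, hk] at hw
              exact absurd hw (hnot _ _)
          · rw [hmv.slot_of_ne hcur, ih]
    have hsm := hstay (max τ τ₀) (le_max_left _ _)
    obtain ⟨τ', hτ, hcur, hhere, hi, hun, o, hmv, hm⟩ := hvisit (max τ τ₀) (by rw [hsm, hk])
    rw [hsm] at hhere
    rcases hmv.of_waiting hun (by rw [hhere, hph]) with ⟨-, h⟩ | ⟨w, hw⟩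
    · rw [hi, hhere] at h
      exact h (h₀ τ' ((le_max_right _ _).trans hτ))
    · rw [hcur, hhere, hk] at hw
      exact hnot _ _ hw
  have inside : ∀ τ, ((st τ p).core.slot j).idx = k →
      ((st τ p).core.slot j).phase = .inside →
      ∃ τ', ((st τ' p).core.slot j).idx = k ∧
        ((st τ p).core.slot j).round + 1 ≤ ((st τ' p).core.slot j).round := by
    intro τ hk hph
    obtain ⟨τ', hτ, hcur, hhere, hi, hun, o, hmv, hm⟩ := hvisit τ hk
    have hw := hmv.of_inside (by rw [hhere, hph])
    rw [hcur, hhere] at hw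
    have := waiting (τ' + 1) (by rw [hw, hk]) (by rw [hw])
    rwa [hw] at this
  have start : ∀ τ, ((st τ p).core.slot j).idx = k →
      ((st τ p).core.slot j).phase = .start →
      ∃ τ', ((st τ' p).core.slot j).idx = k ∧
        ((st τ p).core.slot j).round + 1 ≤ ((st τ' p).core.slot j).round := by
    intro τ hk hph
    obtain ⟨τ', hτ, hcur, hhere, hi, hun, o, hmv, hm⟩ := hvisit τ hk
    have hw := hmv.of_start hun (by rw [hhere, hph])
    rw [hcur, hhere] at hw
    have := inside (τ' + 1) (by rw [hw, hk]) (by rw [hw])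
    rwa [hw] at this
  induction r with
  | zero => exact ⟨τ, hk, Nat.zero_le _⟩
  | succ r ih =>
    obtain ⟨τ₁, hk₁, hr⟩ := ih
    obtain ⟨τ₂, hk₂, hr₂⟩ : ∃ τ', ((st τ' p).core.slot j).idx = k ∧
        ((st τ₁ p).core.slot j).round + 1 ≤ ((st τ' p).core.slot j).round := by
      match hph : ((st τ₁ p).core.slot j).phase with
      | .start => exact start τ₁ hk₁ hph
      | .inside => exact inside τ₁ hk₁ hph
      | .waiting => exact waiting τ₁ hk₁ hph
      | .proposed => exact proposed τ₁ hk₁ hph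
      | .voted => exact voted τ₁ hk₁ hph
    exact ⟨τ₂, hk₂, by omega⟩

/-- An agreement instance that is reached but never decided is blocked by a crashed simulator. -/
theorem blocked (E : Exec I x σ M st) {p : Fin n} (hp : ¬ Faulty σ p)
    (hh : ∀ τ p b, (st τ p).mode ≠ .done b) {j : Fin n} {k : ℕ}
    (hd : ∀ k' < k, ∃ τ w, .dec (j, k') w ∈ M τ) (hu : ∀ τ w, .dec (j, k) w ∉ M τ) :
    ∃ q, Faulty σ q ∧ ∃ τ₀, ∀ τ ≥ τ₀, (st τ q).InZone (j, k) := by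
  by_contra hno
  have hl : ∀ r τ h w, .enter (j, k) r h w ∈ M τ → ∃ τ' b, .leave (j, k) r h w b ∈ M τ' := by
    intro r τ h w hm
    by_contra! hnl
    exact hno (E.stuck_of_not_leave hh hm hnl)
  obtain ⟨r, hr⟩ := E.exists_not_split (j, k)
  obtain ⟨τ, hτ⟩ := E.exists_idx_eq hp hh hd hu
  obtain ⟨τ', hk, hle⟩ := E.round_unbounded hp hh hu hl hτ (r + 1)
  have := E.round_le_of_not_split hr τ' p hk
  omega

end Exec

end

/-! ### Schedules with gaps -/

namespace SnapshotProtocol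

variable {n : ℕ} {A B : Type u} (P : SnapshotProtocol n A B)

/-- The execution driven by a schedule in which no process takes a step at some instants. -/
noncomputable def sparseRun (x : Fin n → A) (s : ℕ → Option (Fin n)) : ℕ → P.Config
  | 0 => ⟨fun i => P.start i (x i), P.mem₀⟩
  | u + 1 =>
    match s u with
    | none => sparseRun x s u
    | some j => P.step (sparseRun x s u) j

theorem sparseRun_congr (x : Fin n → A) {s s' : ℕ → Option (Fin n)} {u : ℕ}
    (h : ∀ i < u, s i = s' i) : P.sparseRun x s u = P.sparseRun x s' u := by
  induction u with
  | zero => rfl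
  | succ u ih =>
    have ih := ih fun i hi => h i (by omega)
    simp only [sparseRun, h u (Nat.lt_succ_self u), ih]

/-- The instants at which some process moves are renumbered by `Nat.nth`; idle instants do not
change the configuration. -/
theorem exists_dense (x : Fin n → A) {s : ℕ → Option (Fin n)}
    (hs : {u | (s u).isSome}.Infinite) :
    ∃ σ : ℕ → Fin n, (∀ u, ∃ m, P.run x σ m = P.sparseRun x s u) ∧
      (∀ m, ∃ u, P.run x σ m = P.sparseRun x s u) ∧
      ∀ j, Faulty σ j ↔ {u | s u = some j}.Finite := by
  classical
  let p : ℕ → Prop := fun u => (s u).isSome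
  have hs : {u | p u}.Infinite := hs
  let σ : ℕ → Fin n := fun m => (s (Nat.nth p m)).get (Nat.nth_mem_of_infinite hs m)
  have hσ : ∀ m, s (Nat.nth p m) = some (σ m) := fun m => (Option.some_get _).symm
  have hrun : ∀ u, P.run x σ (Nat.count p u) = P.sparseRun x s u := by
    intro u
    induction u with
    | zero => simp [run, sparseRun]
    | succ u ih =>
      by_cases hu : p u
      · have h : s u = some (σ (Nat.count p u)) := by
          have := hσ (Nat.count p u)
          rwa [Nat.nth_count hu] at this
        rw [Nat.count_succ, if_pos hu, run, ih, sparseRun, h]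
      · have h : s u = none := by simpa [p] using hu
        rw [Nat.count_succ, if_neg hu, Nat.add_zero, ih, sparseRun, h]
  refine ⟨σ, fun u => ⟨_, hrun u⟩, fun m => ⟨Nat.nth p m, ?_⟩, fun j => ?_⟩
  · rw [← hrun, Nat.count_nth_of_infinite hs]
  · have heq : {u | s u = some j} = Nat.nth p '' {m | σ m = j} := by
      ext u
      constructor
      · intro hu
        have hpu : p u := by simp [p, show s u = some j from hu]
        refine ⟨Nat.count p u, ?_, Nat.nth_count hpu⟩
        have := hσ (Nat.count p u)
        rw [Nat.nth_count hpu, show s u = some j from hu] at this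
        exact (Option.some.inj this).symm
      · rintro ⟨m, hm, rfl⟩
        exact (hσ m).trans (congrArg some hm)
    rw [heq, Set.finite_image_iff (Nat.nth_injective hs).injOn]
    rfl

/-! ### The simulation -/

/-- What is agreed upon for a simulated process: its local state and the contents of its
components of the snapshot objects. -/
abbrev Image : Type u := P.State × (P.Obj → P.Val)

open scoped Classical in
/-- The effect of a step of process `j` when the snapshot objects have contents `m`. -/
noncomputable def advance (j : Fin n) (w : P.Image) (m : P.Obj → Fin n → P.Val) : P.Image :=
  match P.code j w.1 with
  | .decide _ => w
  | .update o v q => (q, Function.update w.2 o v)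
  | .scan o f => (f (m o), w.2)

/-- The next step of process `j` is an update. -/
def IsUpdate (j : Fin n) (w : P.Image) : Prop :=
  ∃ o v q, P.code j w.1 = .update o v q

/-- This allows an update to take effect later than the `get` from which it was computed. -/
theorem advance_of_isUpdate {j : Fin n} {w : P.Image} (h : P.IsUpdate j w)
    (m m' : P.Obj → Fin n → P.Val) : P.advance j w m = P.advance j w m' := by
  obtain ⟨o, v, q, h⟩ := h
  simp [advance, h]

/-- This allows other steps to take effect before their result is published: the memory does not
show them. -/
theorem advance_snd {j : Fin n} {w : P.Image} (h : ¬ P.IsUpdate j w)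
    (m : P.Obj → Fin n → P.Val) : (P.advance j w m).2 = w.2 := by
  unfold advance
  split
  · rfl
  · next o v q hc => exact absurd ⟨o, v, q, hc⟩ h
  · rfl

theorem step_self {C : P.Config} {j : Fin n} {w : P.Image} (hloc : C.loc j = w.1)
    (hmem : ∀ o, C.mem o j = w.2 o) :
    (P.step C j).loc j = (P.advance j w C.mem).1 ∧
      ∀ o, (P.step C j).mem o j = (P.advance j w C.mem).2 o := by
  classical
  match hc : P.code j w.1 with
  | .decide b => simpa [step, advance, hloc, hc] using hmem
  | .update o v q =>
    simp only [step, advance, hloc, hc, Function.update_self, true_and]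
    intro o'
    by_cases ho : o' = o
    · subst ho
      simp
    · simpa [Function.update_of_ne ho] using hmem o'
  | .scan o f => simpa [step, advance, hloc, hc] using hmem

theorem step_of_ne (C : P.Config) {i j : Fin n} (h : j ≠ i) :
    (P.step C i).loc j = C.loc j ∧ ∀ o, (P.step C i).mem o j = C.mem o j := by
  classical
  unfold step
  split
  · exact ⟨rfl, fun _ => rfl⟩
  · next o v q hc =>
    refine ⟨Function.update_of_ne h _ _, fun o' => ?_⟩
    by_cases ho : o' = o
    · subst ho
      simp [Function.update_of_ne h]
    · simp [Function.update_of_ne ho]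
  · exact ⟨Function.update_of_ne h _ _, fun _ => rfl⟩

/-- `w` is the latest decided image of process `i` according to `S`. -/
def LastDec (S : Set (Msg n P.Image)) (i : Fin n) (w : P.Image) : Prop :=
  ∃ k, .dec (i, k) w ∈ S ∧ ∀ k' w', .dec (i, k') w' ∈ S → k' ≤ k

open scoped Classical in
/-- The contents of the snapshot objects according to `S`. -/
noncomputable def memOf (S : Set (Msg n P.Image)) (o : P.Obj) (i : Fin n) : P.Val :=
  if h : ∃ w, P.LastDec S i w then h.choose.2 o else P.mem₀ o i

/-- Some simulated process has decided `b` according to `S`. -/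
def DecidedIn (S : Set (Msg n P.Image)) (b : B) : Prop :=
  ∃ j k w, .dec (j, k) w ∈ S ∧ P.code j w.1 = .decide b

open scoped Classical in
/-- The agreement layer that simulates `P`. -/
noncomputable def simSpec : Spec n A B P.Image where
  init j a := (P.start j a, fun o => P.mem₀ o j)
  next j w S := P.advance j w (P.memOf S)
  out S := if h : ∃ b, P.DecidedIn S b then some h.choose else none

theorem decidedIn_of_out {S : Set (Msg n P.Image)} {b : B} (h : P.simSpec.out S = some b) :
    P.DecidedIn S b := by
  simp only [simSpec] at h
  split at h
  · next hb =>
    rw [← Option.some.inj h]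
    exact hb.choose_spec
  · cases h

theorem out_ne_none {S : Set (Msg n P.Image)} {b : B} (h : P.DecidedIn S b) :
    P.simSpec.out S ≠ none := by
  have hb : ∃ b, P.DecidedIn S b := ⟨b, h⟩
  simp [simSpec, hb]

end SnapshotProtocol

/-! ### Linearization of the simulated steps. -/

namespace Exec

section

variable {n : ℕ} {A B W : Type u} [NeZero n] {I : Spec n A B W} {x : Fin n → A} {σ : ℕ → Fin n}
  {M : ℕ → Set (Msg n W)} {st : ℕ → Fin n → SimState n W B}

theorem dec_of_le (E : Exec I x σ M st) {j : Fin n} {k k' τ : ℕ} (hle : k' ≤ k)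
    (h : ∃ w, .dec (j, k) w ∈ M τ) : ∃ w, .dec (j, k') w ∈ M τ := by
  induction k, hle using Nat.le_induction with
  | base => exact h
  | succ k _ ih =>
    obtain ⟨w, h⟩ := h
    obtain ⟨τ', hτ, -, -, w₀, h₀, -⟩ := E.dec_succ_origin h
    exact ih ⟨w₀, E.mem_mono hτ.le h₀⟩

theorem new_unique (E : Exec I x σ M st) {τ : ℕ} {a b : Msg n W} (ha : a ∈ M (τ + 1))
    (ha' : a ∉ M τ) (hb : b ∈ M (τ + 1)) (hb' : b ∉ M τ) : a = b := by
  have hs := E.step τ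
  generalize M (τ + 1) = S' at hs ha hb
  generalize st (τ + 1) (σ τ) = s' at hs
  cases hs with
  | write m hm => rw [Set.mem_insert_iff] at ha hb; simp_all
  | _ => exact absurd ha ha'

end

variable {n : ℕ} {A B : Type u} [NeZero n] {P : SnapshotProtocol n A B} {x : Fin n → A}
  {σ : ℕ → Fin n} {M : ℕ → Set (Msg n P.Image)} {st : ℕ → Fin n → SimState n P.Image B}

theorem memOf_eq (E : Exec P.simSpec x σ M st) {τ : ℕ} {i : Fin n} {k : ℕ} {w : P.Image}
    (h : .dec (i, k) w ∈ M τ) (hn : ∀ w', .dec (i, k + 1) w' ∉ M τ) (o : P.Obj) :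
    P.memOf (M τ) o i = w.2 o := by
  have hmax : ∀ k' w', .dec (i, k') w' ∈ M τ → k' ≤ k := by
    intro k' w' h'
    by_contra! hlt
    obtain ⟨w₁, h₁⟩ := E.dec_of_le hlt ⟨w', h'⟩
    exact hn w₁ h₁
  have hex : ∃ w, P.LastDec (M τ) i w := ⟨w, k, h, hmax⟩
  obtain ⟨k', h₁, h₂⟩ := hex.choose_spec
  obtain rfl : k' = k := le_antisymm (hmax _ _ h₁) (h₂ _ _ h)
  rw [SnapshotProtocol.memOf, dif_pos hex, E.dec_unique h₁ h]

theorem memOf_of_not_dec (E : Exec P.simSpec x σ M st) {τ : ℕ} {i : Fin n}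
    (hn : ∀ w, .dec (i, 0) w ∉ M τ) (o : P.Obj) : P.memOf (M τ) o i = P.mem₀ o i := by
  rw [SnapshotProtocol.memOf, dif_neg]
  rintro ⟨w, k, h, -⟩
  obtain ⟨w', h'⟩ := E.dec_of_le (Nat.zero_le k) ⟨w, h⟩
  exact hn w' h'

/-- The step of the simulated process `j` that leads to its image number `k + 1` takes effect at
time `τ`. -/
def Event (P : SnapshotProtocol n A B) (σ : ℕ → Fin n) (M : ℕ → Set (Msg n P.Image))
    (st : ℕ → Fin n → SimState n P.Image B) (j : Fin n) (k τ : ℕ) : Prop :=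
  ∃ w₀ w, .dec (j, k) w₀ ∈ M τ ∧ (∀ w', .dec (j, k + 1) w' ∉ M τ) ∧
    (∃ τ', .dec (j, k + 1) w ∈ M τ') ∧ w = P.advance j w₀ (P.memOf (M τ)) ∧
    (P.IsUpdate j w₀ ∧ .dec (j, k + 1) w ∈ M (τ + 1) ∨
      ¬ P.IsUpdate j w₀ ∧ M (τ + 1) = M τ ∧ (st τ (σ τ)).core.cur = j)

/-- A scan must sit at the `get` behind the winning candidate, where its view is current; an update
ignores the view and can sit at its publication, where others begin to see it. -/
theorem exists_event (E : Exec P.simSpec x σ M st) {j : Fin n} {k : ℕ}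
    (h : ∃ τ w, .dec (j, k + 1) w ∈ M τ) : ∃ τ, Event P σ M st j k τ := by
  obtain ⟨τ, w, h⟩ := h
  obtain ⟨τ₁, -, hnot, h₁⟩ := E.exists_first h
  have hnot' : ∀ w', .dec (j, k + 1) w' ∉ M τ₁ := fun w' hw' =>
    hnot (E.dec_unique hw' h ▸ hw')
  obtain ⟨τ', hτ', hr, hcur, w₀, h₀, hw⟩ := E.dec_succ_origin h₁
  have hle : τ' ≤ τ₁ := by omega
  by_cases hup : P.IsUpdate j w₀
  · refine ⟨τ₁, w₀, w, E.mem_mono hle h₀, hnot', ⟨τ, h⟩, ?_, .inl ⟨hup, h₁⟩⟩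
    rw [hw]
    exact P.advance_of_isUpdate hup _ _
  · exact ⟨τ', w₀, w, h₀, fun w' hw' => hnot' w' (E.mem_mono hle hw'), ⟨τ, h⟩, hw,
      .inr ⟨hup, (E.step_ready hr).1, hcur⟩⟩

/-- At an update its decision is the only new value; at any other event the weak set is unchanged
and the turn of the moving simulator names the process. -/
theorem Event.unique (E : Exec P.simSpec x σ M st) {j j' : Fin n} {k k' τ : ℕ}
    (h : Event P σ M st j k τ) (h' : Event P σ M st j' k' τ) : j = j' := by
  obtain ⟨w₀, w, -, hn, -, -, hc⟩ := h
  obtain ⟨w₀', w', -, hn', -, -, hc'⟩ := h'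
  rcases hc with ⟨-, hd⟩ | ⟨-, hM, hcur⟩ <;> rcases hc' with ⟨-, hd'⟩ | ⟨-, hM', hcur'⟩
  · have := E.new_unique hd (hn w) hd' (hn' w')
    simp only [Msg.dec.injEq, Prod.mk.injEq] at this
    exact this.1.1
  · exact absurd (hM' ▸ hd) (hn w)
  · exact absurd (hM ▸ hd') (hn' w')
  · rw [← hcur, ← hcur']

/-- The execution of the simulated protocol that belongs to an execution of the simulators. -/
theorem exists_sparseRun (E : Exec P.simSpec x σ M st) :
    ∃ (x' : Fin n → A) (s : ℕ → Option (Fin n)), Set.range x' ⊆ Set.range x ∧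
      (∀ j k w τ, .dec (j, k) w ∈ M τ → ∃ u ≤ τ, (P.sparseRun x' s u).loc j = w.1) ∧
      (∀ j, (∀ k, ∃ τ w, .dec (j, k) w ∈ M τ) → {u | s u = some j}.Infinite) ∧
      ∀ j, {u | s u = some j}.Infinite → ∀ u, ∃ k w τ, .dec (j, k) w ∈ M τ ∧
        (P.sparseRun x' s u).loc j = w.1 := by
  classical
  have hx' : ∀ j, ∃ a ∈ Set.range x, ∀ τ w, .dec (j, 0) w ∈ M τ → w = P.simSpec.init j a := by
    intro j
    by_cases h : ∃ τ w, .dec (j, 0) w ∈ M τ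
    · obtain ⟨τ, w, h⟩ := h
      obtain ⟨p, rfl⟩ := E.dec_zero h
      exact ⟨x p, ⟨p, rfl⟩, fun τ' w' h' => E.dec_unique h' h⟩
    · push Not at h
      exact ⟨x 0, ⟨0, rfl⟩, fun τ w hw => absurd hw (h τ w)⟩
  choose x' hxr hx' using hx'
  -- `v j k` is the decided image if there is one; the default otherwise is arbitrary, except that
  -- `v j 0` is always the initial image.
  have hv : ∀ j k, ∃ v, (∀ τ w, .dec (j, k) w ∈ M τ → w = v) ∧
      (k = 0 → v = P.simSpec.init j (x' j)) := by
    rintro j (_ | k)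
    · exact ⟨_, hx' j, fun _ => rfl⟩
    · by_cases h : ∃ τ w, .dec (j, k + 1) w ∈ M τ
      · obtain ⟨τ, w, h⟩ := h
        exact ⟨w, fun τ' w' h' => E.dec_unique h' h, by simp⟩
      · push Not at h
        exact ⟨P.simSpec.init j (x' j), fun τ w hw => absurd hw (h τ w), by simp⟩
  choose v hv hv0 using hv
  let D : Fin n → ℕ → Prop := fun j k => ∃ τ w, .dec (j, k) w ∈ M τ
  have hev : ∀ j k, ∃ τ, D j (k + 1) → Event P σ M st j k τ := by
    intro j k
    by_cases h : D j (k + 1)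
    · obtain ⟨τ, hτ⟩ := E.exists_event h
      exact ⟨τ, fun _ => hτ⟩
    · exact ⟨0, fun h' => absurd h' h⟩
  choose ev hev using hev
  -- the event leading to image `k + 1` lies between the decisions on images `k` and `k + 1`
  have ev_dec : ∀ j k, D j (k + 1) → .dec (j, k) (v j k) ∈ M (ev j k) := by
    intro j k h
    obtain ⟨w₀, w, h₀, -⟩ := hev j k h
    exact hv j k _ _ h₀ ▸ h₀
  have ev_not : ∀ j k, D j (k + 1) → ∀ w, .dec (j, k + 1) w ∉ M (ev j k) := by
    intro j k h
    obtain ⟨w₀, w, h₀, hn, -⟩ := hev j k h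
    exact hn
  have ev_adv : ∀ j k, D j (k + 1) →
      v j (k + 1) = P.advance j (v j k) (P.memOf (M (ev j k))) := by
    intro j k h
    obtain ⟨w₀, w, h₀, -, ⟨τ, hτ⟩, hw, -⟩ := hev j k h
    rw [← hv j (k + 1) _ _ hτ, hw, hv j k _ _ h₀]
  have ev_upd : ∀ j k, D j (k + 1) → P.IsUpdate j (v j k) →
      ∃ w, .dec (j, k + 1) w ∈ M (ev j k + 1) := by
    intro j k h hup
    obtain ⟨w₀, w, h₀, -, -, -, ⟨-, hd⟩ | ⟨hnu, -⟩⟩ := hev j k h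
    · exact ⟨w, hd⟩
    · exact absurd (hv j k _ _ h₀ ▸ hup) hnu
  have ev_lt : ∀ j k τ, (∃ w, .dec (j, k + 1) w ∈ M τ) → ev j k < τ := by
    rintro j k τ ⟨w, hw⟩
    by_contra! hle
    exact ev_not j k ⟨τ, w, hw⟩ w (E.mem_mono hle hw)
  have D_of_le : ∀ j k k', k' ≤ k → D j k → D j k' := by
    rintro j k k' hle ⟨τ, h⟩
    exact ⟨τ, E.dec_of_le hle h⟩
  have ev_mono : ∀ j k k', k < k' → D j (k' + 1) → ev j k < ev j k' := by
    intro j k k' hlt h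
    exact ev_lt j k _ (E.dec_of_le hlt ⟨_, ev_dec j k' h⟩)
  let s : ℕ → Option (Fin n) := fun u =>
    if h : ∃ q : Fin n × ℕ, D q.1 (q.2 + 1) ∧ ev q.1 q.2 = u then some h.choose.1 else none
  have s_ev : ∀ j k, D j (k + 1) → s (ev j k) = some j := by
    intro j k h
    have hex : ∃ q : Fin n × ℕ, D q.1 (q.2 + 1) ∧ ev q.1 q.2 = ev j k := ⟨(j, k), h, rfl⟩
    obtain ⟨h₁, h₂⟩ := hex.choose_spec
    have h₃ := hev _ _ h₁
    rw [h₂] at h₃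
    simp only [s, dif_pos hex]
    exact congrArg some (Event.unique E h₃ (hev j k h))
  have s_some : ∀ u j, s u = some j → ∃ k, D j (k + 1) ∧ ev j k = u := by
    intro u j h
    simp only [s] at h
    split at h
    · next hex =>
      obtain rfl := Option.some.inj h
      exact ⟨_, hex.choose_spec⟩
    · cases h
  -- The witness `k` counts the events of `j` before time `u`.
  have inv : ∀ u j, ∃ k, (∀ k' < k, D j (k' + 1) ∧ ev j k' < u) ∧ (D j (k + 1) → u ≤ ev j k) ∧
      (P.sparseRun x' s u).loc j = (v j k).1 ∧
      ∀ o, (P.sparseRun x' s u).mem o j = (v j k).2 o := by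
    intro u
    induction u with
    | zero =>
      intro j
      exact ⟨0, by simp, by simp, by rw [hv0 j 0 rfl]; rfl,
        by rw [hv0 j 0 rfl]; exact fun _ => rfl⟩
    | succ u ih =>
      choose κ hpast hnext hloc hmem using ih
      -- If `K` is the last published image of `i`, then `i` has made `K` or `K + 1` steps; in the
      -- second case the extra step is no update, so the components agree.
      have hview : ∀ i o, P.memOf (M u) o i = (v i (κ i)).2 o := by
        intro i o
        by_cases h0 : ∃ w, .dec (i, 0) w ∈ M u
        · obtain ⟨K, ⟨w, hK⟩, hK'⟩ : ∃ K, (∃ w, .dec (i, K) w ∈ M u) ∧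
              ¬ ∃ w, .dec (i, K + 1) w ∈ M u := by
            -- Otherwise infinitely many events, at strictly increasing instants, would precede time
            -- `u`.
            by_contra! hall
            have hall' : ∀ K, ∃ w, .dec (i, K) w ∈ M u := fun K => by
              induction K with
              | zero => exact h0
              | succ K ihK => exact hall K ihK
            have hD : ∀ k, D i (k + 1) := fun k => ⟨u, hall' (k + 1)⟩
            have hle : ∀ k, k ≤ ev i k := fun k => by
              induction k with
              | zero => exact Nat.zero_le _
              | succ k ihk =>
                exact Nat.succ_le_of_lt (ihk.trans_lt (ev_mono i k _ (by omega) (hD _)))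
            exact absurd (ev_lt i u u (hall' _)) (not_lt.2 (hle u))
          have hge : K ≤ κ i := by
            by_contra! hlt
            have hd := E.dec_of_le hlt ⟨w, hK⟩
            exact absurd (ev_lt _ _ _ hd) (not_lt.2 (hnext i ⟨u, hd⟩))
          have hle : κ i ≤ K + 1 := by
            by_contra! hlt
            obtain ⟨hd, he⟩ := hpast i (K + 1) hlt
            exact hK' ⟨_, E.mem_mono he.le (ev_dec i _ hd)⟩
          rw [E.memOf_eq hK (fun w' hw' => hK' ⟨w', hw'⟩), hv i K _ _ hK]
          rcases Nat.lt_or_ge K (κ i) with hlt | hge'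
          · obtain ⟨hd, he⟩ := hpast i K hlt
            rw [le_antisymm hle hlt, ev_adv i K hd, P.advance_snd]
            intro hup
            obtain ⟨w', hw'⟩ := ev_upd i K hd hup
            exact hK' ⟨w', E.mem_mono he hw'⟩
          · rw [le_antisymm hge hge']
        · push Not at h0
          rw [E.memOf_of_not_dec h0]
          have : κ i = 0 := by
            by_contra hne
            obtain ⟨hd, he⟩ := hpast i 0 (Nat.pos_of_ne_zero hne)
            exact h0 _ (E.mem_mono he.le (ev_dec i _ hd))
          rw [this, hv0 i 0 rfl]
          rfl
      have keep : ∀ j, s u ≠ some j → (∀ k' < κ j, D j (k' + 1) ∧ ev j k' < u + 1) ∧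
          (D j (κ j + 1) → u + 1 ≤ ev j (κ j)) := by
        intro j hj
        refine ⟨fun k' hk' => ⟨(hpast j k' hk').1, by have := (hpast j k' hk').2; omega⟩,
          fun hd => ?_⟩
        have h₁ := hnext j hd
        have h₂ : ev j (κ j) ≠ u := fun heq => hj (heq ▸ s_ev j _ hd)
        omega
      intro j
      match hs : s u with
      | none =>
        have hrun : P.sparseRun x' s (u + 1) = P.sparseRun x' s u := by
          simp only [SnapshotProtocol.sparseRun, hs]
        rw [hrun]
        obtain ⟨h₁, h₂⟩ := keep j (by rw [hs]; simp)
        exact ⟨κ j, h₁, h₂, hloc j, hmem j⟩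
      | some i =>
        have hrun : P.sparseRun x' s (u + 1) = P.step (P.sparseRun x' s u) i := by
          simp only [SnapshotProtocol.sparseRun, hs]
        rw [hrun]
        generalize P.sparseRun x' s u = C at *
        by_cases hji : j = i
        · subst hji
          obtain ⟨k, hd, hk⟩ := s_some u j hs
          obtain rfl : k = κ j := by
            rcases lt_trichotomy k (κ j) with hlt | heq | hlt
            · have := (hpast j k hlt).2
              omega
            · exact heq
            · have h₁ := ev_mono j _ _ hlt hd
              have h₂ := hnext j (D_of_le j _ _ (by omega) hd)
              omega
          refine ⟨κ j + 1, ?_, ?_, ?_⟩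
          · intro k' hk'
            rcases Nat.lt_succ_iff_lt_or_eq.1 hk' with hlt | rfl
            · exact ⟨(hpast j k' hlt).1, by have := (hpast j k' hlt).2; omega⟩
            · exact ⟨hd, by omega⟩
          · intro hd'
            have := ev_mono j (κ j) (κ j + 1) (by omega) hd'
            omega
          · have hadv := ev_adv j (κ j) hd
            rw [hk] at hadv
            rw [hadv, show P.memOf (M u) = C.mem from
              funext fun o => funext fun i => by rw [hview, hmem]]
            exact P.step_self (hloc j) (hmem j)
        · obtain ⟨h₁, h₂⟩ := keep j (by rw [hs]; simpa using Ne.symm hji)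
          obtain ⟨h₃, h₄⟩ := P.step_of_ne C hji
          exact ⟨κ j, h₁, h₂, h₃.trans (hloc j), fun o => (h₄ o).trans (hmem j o)⟩
  refine ⟨x', s, by rintro _ ⟨j, rfl⟩; exact hxr j, ?_, ?_, ?_⟩
  · intro j k w τ hw
    cases k with
    | zero =>
      refine ⟨0, Nat.zero_le _, ?_⟩
      rw [hx' j τ w hw]
      rfl
    | succ k =>
      refine ⟨ev j k + 1, ev_lt j k τ ⟨w, hw⟩, ?_⟩
      have hd : D j (k + 1) := ⟨τ, w, hw⟩
      obtain ⟨i, hpast, hnext, hloc, -⟩ := inv (ev j k + 1) j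
      -- Right after the event `ev j k`, exactly `k + 1` steps of `j` have taken effect.
      have : i = k + 1 := by
        rcases lt_trichotomy i (k + 1) with hlt | heq | hlt
        · have h₁ := hnext (D_of_le j _ _ (by omega) hd)
          rcases Nat.lt_succ_iff_lt_or_eq.1 hlt with hlt | rfl
          · have := ev_mono j _ _ hlt hd
            omega
          · omega
        · exact heq
        · obtain ⟨h₁, h₂⟩ := hpast (k + 1) hlt
          have := ev_mono j k (k + 1) (by omega) h₁
          omega
      rw [hloc, this, hv j (k + 1) τ w hw]
  · intro j hall
    have hD : ∀ k, D j k := hall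
    refine Set.infinite_of_injective_forall_mem (f := ev j) ?_ fun k => s_ev j k (hD _)
    exact (strictMono_nat_of_lt_succ fun k => ev_mono j k _ (by omega) (hD _)).injective
  · intro j hinf u
    obtain ⟨k, hpast, -, hloc, -⟩ := inv u j
    have hD : D j k := by
      cases k with
      | zero =>
        obtain ⟨u, hu⟩ := hinf.nonempty
        obtain ⟨k, hd, -⟩ := s_some u j hu
        exact D_of_le j _ _ (Nat.zero_le _) hd
      | succ k => exact (hpast k (by omega)).1
    obtain ⟨τ, w, hw⟩ := hD
    exact ⟨k, w, τ, hw, by rw [hloc, hv j k τ w hw]⟩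

end Exec

/-! ### Counting crashes and transferring solvability. -/

theorem exists_not_faulty {n t : ℕ} (htn : t < n) {σ : ℕ → Fin n} (h : AtMostFaulty t σ) :
    ∃ p, ¬ Faulty σ p := by
  by_contra! hall
  have : {i : Fin n | Faulty σ i} = Set.univ := Set.eq_univ_of_forall hall
  rw [AtMostFaulty, this, Set.ncard_univ, Nat.card_fin] at h
  omega

/-- Only as many simulated processes are blocked as simulators crash. -/
theorem Exec.ncard_blocked_le {n : ℕ} {A B W : Type u} [NeZero n] {I : Spec n A B W}
    {x : Fin n → A} {σ : ℕ → Fin n} {M : ℕ → Set (Msg n W)} {st : ℕ → Fin n → SimState n W B}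
    (E : Exec I x σ M st) {p : Fin n} (hp : ¬ Faulty σ p)
    (hh : ∀ τ p b, (st τ p).mode ≠ .done b) :
    {j | ∃ k, ∀ τ w, Msg.dec (j, k) w ∉ M τ}.ncard ≤ {i | Faulty σ i}.ncard := by
  classical
  have h : ∀ j ∈ {j | ∃ k, ∀ τ w, Msg.dec (j, k) w ∉ M τ},
      ∃ q, Faulty σ q ∧ ∃ k τ₀, ∀ τ ≥ τ₀, (st τ q).InZone (j, k) := by
    intro j hj
    -- The first undecided instance of `j` is the one that is reached and blocked.
    obtain ⟨q, hq, hz⟩ := E.blocked hp hh (j := j) (k := Nat.find hj)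
      (fun k' hk' => by simpa using Nat.find_min hj hk') (Nat.find_spec hj)
    exact ⟨q, hq, _, hz⟩
  choose! f hf k τ₀ hz using h
  refine Set.ncard_le_ncard_of_injOn f hf ?_ (Set.toFinite _)
  intro j hj j' hj' heq
  have h₁ := hz j hj _ (le_max_left (τ₀ j) (τ₀ j'))
  have h₂ := hz j' hj' _ (le_max_right (τ₀ j) (τ₀ j'))
  rw [← heq] at h₂
  exact congrArg Prod.fst (h₁.unique h₂)

theorem SnapshotProtocol.simulates_simSpec {n t : ℕ} [NeZero n] (htn : t < n) {A B : Type u}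
    (P : SnapshotProtocol n A B) : P.simSpec.protocol.Simulates t P := by
  intro x σ hσ
  simp only [Spec.decides_iff]
  have E := P.simSpec.exec_protocol x σ
  revert E
  generalize (fun τ => (P.simSpec.protocol.run x σ τ).mem (0 : Fin 1)) = M
  generalize hst : (fun τ => (P.simSpec.protocol.run x σ τ).loc) = st
  intro E
  change ℕ → Set (Msg n P.Image) at M
  change ℕ → Fin n → SimState n P.Image B at st
  have hst' : ∀ τ p, (P.simSpec.protocol.run x σ τ).loc p = st τ p := fun τ p => by rw [← hst]
  simp only [hst']
  obtain ⟨x', s, hx', hdec, hinf, hlive⟩ := E.exists_sparseRun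
  by_cases hh : ∃ τ p b, (st τ p).mode = .done b
  · obtain ⟨T, hT⟩ : ∃ T, ∀ p b τ, (st τ p).mode = .done b → (st T p).mode = .done b := by
      have : ∀ p, ∃ T, ∀ b τ, (st τ p).mode = .done b → (st T p).mode = .done b := by
        intro p
        by_cases h : ∃ T b, (st T p).mode = .done b
        · obtain ⟨T, b, hb⟩ := h
          refine ⟨T, fun b' τ hb' => ?_⟩
          have h₁ := E.done_mono (le_max_left T τ) hb
          have h₂ := E.done_mono (le_max_right T τ) hb'
          rw [hb, ← h₁, h₂]
        · push Not at h
          exact ⟨0, fun b τ hb => absurd hb (h τ b)⟩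
      choose T hT using this
      refine ⟨Finset.univ.sup T, fun p b τ hb => ?_⟩
      exact E.done_mono (Finset.le_sup (Finset.mem_univ p)) (hT p b τ hb)
    -- By time `T` every simulator that ever halts has halted, so the decisions they read are kept;
    -- round robin afterwards lets no process crash.
    let s' : ℕ → Option (Fin n) := fun u => if u < T then s u else some (Fin.ofNat n u)
    have hs' : ∀ j, {u | s' u = some j}.Infinite := by
      intro j
      refine Set.infinite_of_forall_exists_gt fun a => ⟨j + n * (a + T + 1), ?_, ?_⟩
      · have hle : a + T + 1 ≤ n * (a + T + 1) := Nat.le_mul_of_pos_left _ (NeZero.pos n)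
        have hj : Fin.ofNat n (j + n * (a + T + 1)) = j := by
          ext
          simp [Nat.mod_eq_of_lt j.isLt]
        simp only [s', Set.mem_ofPred_eq, if_neg (show ¬ (j + n * (a + T + 1) < T) by omega), hj]
      · have hle : a + T + 1 ≤ n * (a + T + 1) := Nat.le_mul_of_pos_left _ (NeZero.pos n)
        omega
    obtain ⟨σ', hrun, -, hfault⟩ := P.exists_dense x' (s := s')
      ((hs' 0).mono fun u hu => by simp [show s' u = some 0 from hu])
    refine ⟨x', σ', ?_, hx', ?_, ?_⟩
    · have : {i : Fin n | Faulty σ' i} = ∅ := by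
        ext i
        simpa [hfault i] using hs' i
      rw [AtMostFaulty, this, Set.ncard_empty]
      exact Nat.zero_le t
    · rintro i b ⟨τ, hb⟩
      obtain ⟨τ', hτ', ho⟩ := E.done_out (hT i b τ hb)
      obtain ⟨j, k, w, hw, hc⟩ := P.decidedIn_of_out ho
      obtain ⟨u, hu, hloc⟩ := hdec j k w τ' hw
      obtain ⟨m, hm⟩ := hrun u
      refine ⟨j, m, ?_⟩
      have hcongr : P.sparseRun x' s' u = P.sparseRun x' s u :=
        P.sparseRun_congr x' fun i hi => if_pos (by omega)
      rw [hm, hcongr, hloc, hc]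
    · intro _ i hi
      obtain ⟨τ, p, b, hb⟩ := hh
      obtain ⟨τ', -, ho⟩ := E.done_out hb
      obtain ⟨j, k, w, hw, hc⟩ := P.decidedIn_of_out ho
      obtain ⟨τ₁, b₁, h₁⟩ := E.halts_of_out hi (τ₀ := τ') fun τ hτ =>
        P.out_ne_none ⟨j, k, w, E.mem_mono hτ hw, hc⟩
      exact ⟨b₁, τ₁, h₁⟩
  · push Not at hh
    obtain ⟨p, hp⟩ := exists_not_faulty htn hσ
    have hcard := (E.ncard_blocked_le hp hh).trans hσ
    obtain ⟨j₀, hj₀⟩ : ∃ j, ∀ k, ∃ τ w, .dec (j, k) w ∈ M τ := by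
      by_contra! hall
      have huniv : {j | ∃ k, ∀ τ w, Msg.dec (j, k) w ∉ M τ} = Set.univ :=
        Set.eq_univ_of_forall hall
      rw [huniv, Set.ncard_univ, Nat.card_fin] at hcard
      omega
    obtain ⟨σ', -, hrun, hfault⟩ := P.exists_dense x' (s := s)
      ((hinf j₀ hj₀).mono fun u hu => by simp [show s u = some j₀ from hu])
    refine ⟨x', σ', ?_, hx', fun i b ⟨τ, hb⟩ => absurd hb (hh τ i b), ?_⟩
    -- A simulated process that crashes is blocked, as an unblocked one has infinitely many events.
    · refine le_trans (Set.ncard_le_ncard (fun j hj => ?_) (Set.toFinite _)) hcard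
      by_contra hnot
      simp only [Set.mem_ofPred_eq, not_exists, not_forall, not_not] at hnot
      exact hinf j hnot ((hfault j).1 hj)
    · rintro ⟨j, hj, b, m, hb⟩
      obtain ⟨u, hu⟩ := hrun m
      obtain ⟨k, w, τ, hw, hloc⟩ := hlive j (fun h => hj ((hfault j).2 h)) u
      rw [hu, hloc] at hb
      -- The deciding state is a published image, which would make the correct simulator `p` halt.
      obtain ⟨τ₁, b₁, h₁⟩ := E.halts_of_out hp (τ₀ := τ) fun τ' hτ =>
        P.out_ne_none ⟨j, k, w, E.mem_mono hτ hw, hb⟩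
      exact absurd h₁ (hh _ _ _)

/-- A protocol that simulates a solution of a colorless task solves it. -/
theorem WeakSetProtocol.Simulates.solves {n t : ℕ} (htn : t < n) {A B : Type u}
    {P : SnapshotProtocol n A B} {Q : WeakSetProtocol A B} (hQ : Q.Simulates t P)
    {T : ColorlessTask A B} (hP : P.Solves t T) : Q.Solves n t T := by
  classical
  intro s hs x hx σ hσ
  obtain ⟨x', σ', hσ', hx', hdec, hlive⟩ := hQ x σ hσ
  obtain ⟨hterm, s', hs', hval⟩ := hP s hs x' (fun i => by
    obtain ⟨j, hj⟩ := hx' ⟨i, rfl⟩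
    exact hj ▸ hx j) σ' hσ'
  obtain ⟨j, hj⟩ := exists_not_faulty htn hσ'
  have hall := hlive ⟨j, hj, hterm j hj⟩
  -- The simulators may decide only part of the values of `s'`; this is again a face, being nonempty
  -- because a correct simulator decides.
  refine ⟨hall, s'.filter fun b => ∃ i, Q.Decides x σ i b, ?_, ?_⟩
  · refine (T.carrier s).isRelLowerSet_faces.mem_of_le hs' (Finset.filter_subset _ s') ?_
    obtain ⟨i, hi⟩ := exists_not_faulty htn hσ
    obtain ⟨b, hb⟩ := hall i hi
    have hmem : b ∈ (s' : Set B) := by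
      rw [hval]
      exact hdec i b hb
    exact ⟨b, Finset.mem_filter.2 ⟨hmem, i, hb⟩⟩
  · ext b
    simp only [Finset.coe_filter, Set.mem_ofPred_eq]
    refine ⟨fun h => h.2, fun ⟨i, hi⟩ => ⟨?_, i, hi⟩⟩
    have hmem : b ∈ (s' : Set B) := by
      rw [hval]
      exact hdec i b hi
    exact hmem

end Resilient

theorem mainTheorem2 {A B : Type u} (n t : ℕ) (htn : t < n) :
    (∀ P : Resilient.SnapshotProtocol n A B,
        ∃ Q : Resilient.WeakSetProtocol A B, Q.Simulates t P) ∧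
      (∀ T : Resilient.ColorlessTask A B,
        Resilient.SolvableNonAnonymously n t T → Resilient.SolvableAnonymously n t T) := by
  have : NeZero n := ⟨by omega⟩
  have hsim : ∀ P : Resilient.SnapshotProtocol n A B,
      ∃ Q : Resilient.WeakSetProtocol A B, Q.Simulates t P :=
    fun P => ⟨_, P.simulates_simSpec htn⟩
  refine ⟨hsim, ?_⟩
  rintro T ⟨P, hP⟩
  obtain ⟨Q, hQ⟩ := hsim P
  exact ⟨Q, hQ.solves htn hP⟩
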